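/- Let $n \ge 38$ be an integer, let $K \ge n-5$ be a real number and put $\eta = \frac{K-n+5}{K+n-5} \in [0,1)$. Let $F_{2,2,n}$ be the Fock space of $4n$ modes in the Segal--Bargmann representation: the Hilbert space of holomorphic functions $\psi(z,z')$, $z=(z_{k,i})$, $z'=(z'_{k,j})$ with $1\le k\le n$ and $i,j\in\{1,2\}$, such that $\|\psi\|^2=\pi^{-4n}\int_{\mathbb C^{2n}\times\mathbb C^{2n}} e^{-|z|^2-|z'|^2}|\psi(z,z')|^2\,dz\,dz'<\infty$. Let $\mathcal D$ be the set of complex $2\times2$ matrices $\Lambda$ such that $1-\Lambda\Lambda^\dagger$ is positive definite, and for $\Lambda\in\mathcal D$ let $|\Lambda,n\rangle\in F_{2,2,n}$ be the coherent state $$\psi_{\Lambda,n}(z,z')=\det(1-\Lambda\Lambda^\dagger)^{n/2}\exp\Big(\sum_{i,j=1}^2\Lambda_{ij}Z_{ij}\Big),\qquad Z_{ij}=\sum_{k=1}^n z_{k,i}z'_{k,j}.$$ Let $\mu_n$ be the measure $$d\mu_n(\Lambda)=\frac{(n-1)(n-2)^2(n-3)}{\pi^4\det(1-\Lambda\Lambda^\dagger)^4}\prod_{i,j=1}^2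 d\,\mathrm{Re}(\Lambda_{ij})\,d\,\mathrm{Im}(\Lambda_{ij})$$ on $\mathcal D$, and let $\mathcal D_\eta$ be the set of complex $2\times2$ matrices $\Lambda$ such that $\eta 1-\Lambda\Lambda^\dagger$ is positive semidefinite. Then the operator-valued function $\Lambda\mapsto|\Lambda,n\rangle\langle\Lambda,n|$ is integrable over $\mathcal D_\eta$ with respect to $\mu_n$, its integral is a trace-class operator on $F_{2,2,n}$, and its trace $$T(n,\eta):=\mathrm{tr}\int_{\mathcal D_\eta}|\Lambda,n\rangle\langle\Lambda,n|\,d\mu_n(\Lambda)$$ satisfies $$T(n,\eta)=\frac{(n-1)(n-2)^2(n-3)\,\eta^4}{12(1-\eta)^4},\qquad T(n,\eta)\le\frac{K^4}{100},\qquad T(n,\eta)+1\le\frac{K^4}{100}.$$ -/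

import Mathlib

open MeasureTheory Complex Filter Topology
open scoped ComplexConjugate ComplexOrder ENNReal

noncomputable section

namespace SU22

/-- The phase space `ℂ^{2n} × ℂ^{2n}`: a point is a pair `(z, z')`, with `z k i` and `z' k j` the
coordinates `z_{k,i}` and `z'_{k,j}` for `k ≤ n` and `i, j ∈ {1, 2}`. -/
abbrev Modes (n : ℕ) : Type := (Fin n → Fin 2 → ℂ) × (Fin n → Fin 2 → ℂ)

/-- `|z|² + |z'|²`. -/
def sqNorm {n : ℕ} (p : Modes n) : ℝ := (∑ k, ∑ i, ‖p.1 k i‖ ^ 2) + ∑ k, ∑ j, ‖p.2 k j‖ ^ 2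

/-- The Gaussian measure `π^{-4n} exp (-|z|² - |z'|²) dz dz'`. -/
def gaussian (n : ℕ) : Measure (Modes n) :=
  volume.withDensity fun p => ENNReal.ofReal ((Real.pi ^ (4 * n))⁻¹ * Real.exp (-sqNorm p))

/-- The subspace of `L²` of the Gaussian measure formed by the (classes of) holomorphic functions
on `ℂ^{4n}`. -/
def fockSubmodule (n : ℕ) : Submodule ℂ (Lp ℂ 2 (gaussian n)) where
  carrier := {f | ∃ g : Modes n → ℂ, Differentiable ℂ g ∧ f =ᵐ[gaussian n] g}
  zero_mem' := ⟨0, differentiable_const 0, Lp.coeFn_zero _ _ _⟩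
  add_mem' := by
    rintro f₁ f₂ ⟨g₁, h₁, e₁⟩ ⟨g₂, h₂, e₂⟩
    exact ⟨g₁ + g₂, h₁.add h₂, (Lp.coeFn_add _ _).trans (e₁.add e₂)⟩
  smul_mem' := by
    rintro c f ⟨g, h, e⟩
    exact ⟨c • g, h.const_smul c, (Lp.coeFn_smul _ _).trans (e.const_smul c)⟩

/-! ### The Fock space is complete -/

instance isAddHaarMeasure_modes (n : ℕ) : (volume : Measure (Modes n)).IsAddHaarMeasure := by
  have : (volume : Measure (Fin n → Fin 2 → ℂ)).IsAddHaarMeasure :=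
    Measure.pi.isAddHaarMeasure (fun _ => volume)
  exact Measure.prod.instIsAddHaarMeasure _ _

instance sigmaFinite_modes (n : ℕ) : SigmaFinite (volume : Measure (Modes n)) := by
  exact Measure.prod.instSigmaFinite

lemma integrable_exp_neg_sqNorm (n : ℕ) {a : ℝ} (ha : 0 < a) :
    Integrable (fun p : Modes n => Real.exp (-a * sqNorm p)) := by
  have h0 : Integrable (fun z : ℂ => Real.exp (-a * ‖z‖ ^ 2)) := by
    have h := (GaussianFourier.integrable_cexp_neg_mul_sq_norm_add (b := (a : ℂ)) (V := ℂ)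
      (by simpa using ha) 0 0).norm
    refine h.congr (Eventually.of_forall fun z => ?_)
    simp only [zero_mul, add_zero]
    rw [Complex.norm_exp]
    congr 1
    norm_cast
  have h2 : Integrable (fun z : Fin n → Fin 2 → ℂ => ∏ k, ∏ i, Real.exp (-a * ‖z k i‖ ^ 2)) :=
    Integrable.fintype_prod (f := fun (_ : Fin n) (z : Fin 2 → ℂ) =>
      ∏ i, Real.exp (-a * ‖z i‖ ^ 2)) (fun _ => Integrable.fintype_prod (fun _ => h0))
  refine (h2.mul_prod h2).congr (Eventually.of_forall fun p => ?_)
  simp only [← Real.exp_sum, ← Real.exp_add, sqNorm, mul_add, Finset.mul_sum]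

instance isFiniteMeasure_gaussian (n : ℕ) : IsFiniteMeasure (gaussian n) := by
  refine isFiniteMeasure_withDensity_ofReal ?_
  have h := (integrable_exp_neg_sqNorm n one_pos).const_mul (Real.pi ^ (4 * n))⁻¹
  simp only [neg_mul, one_mul] at h
  exact h.hasFiniteIntegral

lemma continuous_sqNorm (n : ℕ) : Continuous (sqNorm (n := n)) := by
  unfold sqNorm; fun_prop

lemma measurePreserving_rot (n : ℕ) (c : ℂ) (hc : ‖c‖ = 1) :
    MeasurePreserving (fun p : Modes n => c • p) := by
  have h1 : MeasurePreserving (fun z : ℂ => c • z) := by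
    have := (rotation ⟨c, by simpa [Submonoid.unitSphere] using hc⟩).measurePreserving
    exact this
  have h2 : MeasurePreserving (fun z : Fin n → Fin 2 → ℂ => c • z) :=
    volume_preserving_pi (fun _ => volume_preserving_pi (fun _ => h1))
  exact h2.prod h2

/-- Mean value inequality on a ball. -/
lemma mean_value_ball {n : ℕ} {h : Modes n → ℂ} (hh : Differentiable ℂ h) :
    ‖h 0‖ₑ * volume (Metric.ball (0 : Modes n) 1) ≤
      ∫⁻ w in Metric.ball (0 : Modes n) 1, ‖h w‖ₑ := by
  set B := Metric.ball (0 : Modes n) 1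
  set I := Set.Ioc (0 : ℝ) (2 * Real.pi)
  set e : ℝ → ℂ := fun θ => circleMap 0 1 θ
  have hcont : Continuous h := hh.continuous
  have he : ∀ θ, ‖e θ‖ = 1 := fun θ => by simp [e]
  have hce : Continuous e := continuous_circleMap 0 1
  have hpi : (0 : ℝ) < 2 * Real.pi := by positivity
  have key : ∀ w : Modes n, ‖h 0‖ₑ * ENNReal.ofReal (2 * Real.pi) ≤ ∫⁻ θ in I, ‖h (e θ • w)‖ₑ := by
    intro w
    have hd : Differentiable ℂ (fun t : ℂ => h (t • w)) :=
      hh.comp (differentiable_id.smul_const w)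
    have h1 := (hd.diffContOnCl (s := Metric.ball 0 |(1 : ℝ)|)).circleAverage
    rw [Real.circleAverage_def] at h1
    simp only [zero_smul] at h1
    rw [intervalIntegral.integral_of_le hpi.le] at h1
    have h2 : ‖∫ θ in I, h (e θ • w)‖ₑ ≤ ∫⁻ θ in I, ‖h (e θ • w)‖ₑ :=
      enorm_integral_le_lintegral_enorm _
    refine le_trans (le_of_eq ?_) h2
    rw [← h1, enorm_smul]
    have : ‖(2 * Real.pi)⁻¹‖ₑ = (ENNReal.ofReal (2 * Real.pi))⁻¹ := by
      rw [Real.enorm_eq_ofReal (by positivity), ENNReal.ofReal_inv_of_pos hpi]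
    rw [this, mul_comm, ← mul_assoc, ENNReal.mul_inv_cancel, one_mul]
    · simpa using Real.pi_pos
    · exact ENNReal.ofReal_ne_top
  have hinv : ∀ θ, ∫⁻ w in B, ‖h (e θ • w)‖ₑ = ∫⁻ w in B, ‖h w‖ₑ := by
    intro θ
    have hm := (measurePreserving_rot n (e θ) (he θ)).restrict_preimage
      (s := B) Metric.isOpen_ball.measurableSet
    have hB : (fun p : Modes n => e θ • p) ⁻¹' B = B := by
      ext p; simp [B, norm_smul, he]
    rw [hB] at hm
    exact hm.lintegral_comp (f := fun w => ‖h w‖ₑ) hcont.measurable.enorm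
  have hm : ∫⁻ _ in B, (‖h 0‖ₑ * ENNReal.ofReal (2 * Real.pi)) ≤
      ∫⁻ w in B, ∫⁻ θ in I, ‖h (e θ • w)‖ₑ := lintegral_mono key
  rw [lintegral_lintegral_swap] at hm
  · simp only [hinv, lintegral_const, Measure.restrict_apply_univ] at hm
    have hI : volume I = ENNReal.ofReal (2 * Real.pi) := by simp [I]
    rw [hI, mul_right_comm] at hm
    exact (ENNReal.mul_le_mul_iff_left (by simpa using Real.pi_pos) ENNReal.ofReal_ne_top).1 hm
  · refine Measurable.aemeasurable ?_
    refine Measurable.enorm (Continuous.measurable ?_)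
    exact hcont.comp ((hce.comp continuous_snd).smul continuous_fst)

lemma density_pos {n : ℕ} (p : Modes n) :
    0 < (Real.pi ^ (4 * n))⁻¹ * Real.exp (-sqNorm p) := by positivity

/-- On bounded sets, holomorphic functions are controlled by their `L²` norm. -/
lemma exists_bound (n : ℕ) (R : ℝ) : ∃ C : ℝ≥0∞, C ≠ ∞ ∧ ∀ g : Modes n → ℂ, Differentiable ℂ g →
    ∀ z, ‖z‖ ≤ R → ‖g z‖ₑ ≤ C * eLpNorm g 2 (gaussian n) := by
  set ρ : Modes n → ℝ := fun p => (Real.pi ^ (4 * n))⁻¹ * Real.exp (-sqNorm p)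
  have hρ : Continuous ρ := by
    have := continuous_sqNorm n
    fun_prop
  have hBm : ∀ z : Modes n, MeasurableSet (Metric.ball z 1) :=
    fun z => Metric.isOpen_ball.measurableSet
  set S := Metric.closedBall (0 : Modes n) (R + 1)
  have hS : IsCompact S := isCompact_closedBall _ _
  have hfin : gaussian n S ≠ ∞ := measure_ne_top _ _
  obtain ⟨c, hc0, hc⟩ : ∃ c : ℝ, 0 < c ∧ ∀ p ∈ S, c ≤ ρ p := by
    rcases S.eq_empty_or_nonempty with h | h
    · exact ⟨1, one_pos, by simp [h]⟩
    · obtain ⟨p, hp, hmin⟩ := hS.exists_isMinOn h hρ.continuousOn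
      exact ⟨ρ p, density_pos p, fun q hq => hmin hq⟩
  set V := volume (Metric.ball (0 : Modes n) 1)
  have hV0 : V ≠ 0 := (Metric.measure_ball_pos _ _ one_pos).ne'
  have hVt : V ≠ ∞ := measure_ball_lt_top.ne
  have hc0' : ENNReal.ofReal c ≠ 0 := by simpa using hc0
  refine ⟨V⁻¹ * ((ENNReal.ofReal c)⁻¹ * gaussian n S ^ (1 / (1 : ℝ≥0∞).toReal - 1 / (2 : ℝ≥0∞).toReal)), ?_, ?_⟩
  · refine ENNReal.mul_ne_top (by simpa using hV0) (ENNReal.mul_ne_top (by simpa using hc0) ?_)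
    exact ENNReal.rpow_ne_top_of_nonneg (by norm_num) hfin
  intro g hg z hz
  have h1 := mean_value_ball (h := fun w => g (z + w))
    (hg.comp ((differentiable_const z).add differentiable_id))
  simp only [add_zero] at h1
  have h2 : ∫⁻ w in Metric.ball (0 : Modes n) 1, ‖g (z + w)‖ₑ = ∫⁻ w in Metric.ball z 1, ‖g w‖ₑ := by
    have : MeasurableAdd (Modes n) := ContinuousAdd.measurableAdd
    have hm := (measurePreserving_add_left (volume : Measure (Modes n)) z).restrict_preimage
      (hBm z)
    have hB : (fun w => z + w) ⁻¹' Metric.ball z 1 = Metric.ball (0 : Modes n) 1 := by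
      ext w; simp [dist_eq_norm]
    rw [hB] at hm
    exact hm.lintegral_comp (f := fun w => ‖g w‖ₑ) hg.continuous.measurable.enorm
  have hsub : Metric.ball z 1 ⊆ S := by
    intro w hw
    simp only [S, Metric.mem_closedBall, dist_zero_right]
    have : ‖w - z‖ < 1 := by simpa [dist_eq_norm] using hw
    calc ‖w‖ = ‖z + (w - z)‖ := by simp
      _ ≤ ‖z‖ + ‖w - z‖ := norm_add_le _ _
      _ ≤ R + 1 := by linarith
  have h3 : ENNReal.ofReal c * ∫⁻ w in Metric.ball z 1, ‖g w‖ₑ ≤ ∫⁻ w in S, ‖g w‖ₑ ∂(gaussian n) := by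
    rw [gaussian, restrict_withDensity hS.measurableSet,
      lintegral_withDensity_eq_lintegral_mul _ (by exact hρ.measurable.ennreal_ofReal)
        hg.continuous.measurable.enorm,
      ← lintegral_const_mul _ hg.continuous.measurable.enorm]
    calc _ ≤ ∫⁻ w in S, ENNReal.ofReal c * ‖g w‖ₑ := lintegral_mono_set hsub
      _ ≤ _ := by
        refine setLIntegral_mono' hS.measurableSet fun w hw => ?_
        exact mul_le_mul_left (ENNReal.ofReal_le_ofReal (hc w hw)) _
  have h4 := eLpNorm_le_eLpNorm_mul_rpow_measure_univ (p := 1) (q := 2)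
    (μ := (gaussian n).restrict S) (f := g) (by norm_num)
    hg.continuous.aestronglyMeasurable
  rw [eLpNorm_one_eq_lintegral_enorm, Measure.restrict_apply_univ] at h4
  have h5 : eLpNorm g 2 ((gaussian n).restrict S) ≤ eLpNorm g 2 (gaussian n) :=
    eLpNorm_mono_measure _ Measure.restrict_le_self
  have h6 : ENNReal.ofReal c * (‖g z‖ₑ * V) ≤ eLpNorm g 2 (gaussian n) *
      gaussian n S ^ (1 / (1 : ℝ≥0∞).toReal - 1 / (2 : ℝ≥0∞).toReal) :=
    calc _ ≤ ENNReal.ofReal c * ∫⁻ w in Metric.ball z 1, ‖g w‖ₑ := by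
            rw [← h2]; exact mul_le_mul_right h1 _
      _ ≤ _ := h3.trans (h4.trans (mul_le_mul_left h5 _))
  have h7 : ‖g z‖ₑ = V⁻¹ * ((ENNReal.ofReal c)⁻¹ * (ENNReal.ofReal c * (‖g z‖ₑ * V))) := by
    rw [← mul_assoc (ENNReal.ofReal c)⁻¹, ENNReal.inv_mul_cancel hc0' ENNReal.ofReal_ne_top,
      one_mul, mul_comm ‖g z‖ₑ, ← mul_assoc, ENNReal.inv_mul_cancel hV0 hVt, one_mul]
  rw [h7]
  calc _ ≤ V⁻¹ * ((ENNReal.ofReal c)⁻¹ * (eLpNorm g 2 (gaussian n) *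
      gaussian n S ^ (1 / (1 : ℝ≥0∞).toReal - 1 / (2 : ℝ≥0∞).toReal))) := by gcongr
    _ = _ := by ring

lemma exists_bound_real (n : ℕ) (R : ℝ) : ∃ C : ℝ, 0 ≤ C ∧ ∀ (f : Lp ℂ 2 (gaussian n))
    (g : Modes n → ℂ), Differentiable ℂ g → f =ᵐ[gaussian n] g →
    ∀ z, ‖z‖ ≤ R → ‖g z‖ ≤ C * ‖f‖ := by
  obtain ⟨C, hC, h⟩ := exists_bound n R
  refine ⟨C.toReal, ENNReal.toReal_nonneg, fun f g hg hfg z hz => ?_⟩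
  have h1 := h g hg z hz
  rw [← eLpNorm_congr_ae hfg] at h1
  have h2 := ENNReal.toReal_mono (ENNReal.mul_ne_top hC (Lp.eLpNorm_ne_top f)) h1
  rwa [ENNReal.toReal_mul, toReal_enorm, ← Lp.norm_def] at h2

/-- Cauchy's estimate for the derivative. -/
lemma norm_fderiv_le {n : ℕ} {g : Modes n → ℂ} (hg : Differentiable ℂ g) {z : Modes n} {M : ℝ}
    (hM : 0 ≤ M) (h : ∀ w, ‖w‖ ≤ ‖z‖ + 1 → ‖g w‖ ≤ M) : ‖fderiv ℂ g z‖ ≤ M := by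
  refine ContinuousLinearMap.opNorm_le_of_unit_norm hM fun v hv => ?_
  have hd : Differentiable ℂ (fun t : ℂ => g (z + t • v)) :=
    hg.comp ((differentiable_const z).add (differentiable_id.smul_const v))
  have h1 : deriv (fun t : ℂ => g (z + t • v)) 0 = fderiv ℂ g z v := by
    have h2 : HasDerivAt (fun t : ℂ => z + t • v) v 0 := by
      simpa using ((hasDerivAt_id (0 : ℂ)).smul_const v).const_add z
    have h3 : HasFDerivAt g (fderiv ℂ g z) (z + (0 : ℂ) • v) := by
      simpa using (hg z).hasFDerivAt
    exact (h3.comp_hasDerivAt (0 : ℂ) h2).deriv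
  rw [← h1]
  have h4 := Complex.norm_deriv_le_of_forall_mem_sphere_norm_le (c := 0) (R := 1) (C := M)
    one_pos hd.diffContOnCl (fun t ht => h _ ?_)
  · simpa using h4
  · have ht' : ‖t‖ = 1 := by simpa using ht
    calc ‖z + t • v‖ ≤ ‖z‖ + ‖t • v‖ := norm_add_le _ _
      _ = ‖z‖ + 1 := by rw [norm_smul, ht', hv, one_mul]

lemma isClosed_fock (n : ℕ) : IsClosed (fockSubmodule n : Set (Lp ℂ 2 (gaussian n))) := by
  refine IsSeqClosed.isClosed ?_
  intro f f₀ hf hlim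
  choose g hg hfg using hf
  have hcau : CauchySeq f := hlim.cauchySeq
  have hsub : ∀ i j, (f i - f j : Lp ℂ 2 (gaussian n)) =ᵐ[gaussian n] g i - g j := fun i j =>
    (Lp.coeFn_sub _ _).trans ((hfg i).sub (hfg j))
  have hpt : ∀ z, CauchySeq fun i => g i z := by
    intro z
    obtain ⟨C, hC, hb⟩ := exists_bound_real n ‖z‖
    rw [Metric.cauchySeq_iff] at hcau ⊢
    intro ε hε
    obtain ⟨N, hN⟩ := hcau (ε / (C + 1)) (by positivity)
    refine ⟨N, fun i hi j hj => ?_⟩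
    have h1 := hb _ _ ((hg i).sub (hg j)) (hsub i j) z le_rfl
    have h2 := hN i hi j hj
    rw [dist_eq_norm] at h2 ⊢
    rw [lt_div_iff₀ (by positivity)] at h2
    simp only [Pi.sub_apply] at h1
    nlinarith [norm_nonneg (f i - f j)]
  choose g₀ hg₀ using fun z => cauchySeq_tendsto_of_complete (hpt z)
  have hder : ∀ R : ℝ, UniformCauchySeqOn (fun i z => fderiv ℂ (g i) z) atTop
      (Metric.ball (0 : Modes n) R) := by
    intro R
    obtain ⟨C, hC, hb⟩ := exists_bound_real n (R + 1)
    rw [Metric.uniformCauchySeqOn_iff]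
    rw [Metric.cauchySeq_iff] at hcau
    intro ε hε
    obtain ⟨N, hN⟩ := hcau (ε / (C + 1)) (by positivity)
    refine ⟨N, fun i hi j hj z hz => ?_⟩
    have hz' : ‖z‖ < R := by simpa using hz
    have h1 : ‖fderiv ℂ (g i - g j) z‖ ≤ C * ‖f i - f j‖ :=
      norm_fderiv_le ((hg i).sub (hg j)) (by positivity) fun w hw =>
        hb _ _ ((hg i).sub (hg j)) (hsub i j) w (by linarith)
    have h2 := hN i hi j hj
    rw [fderiv_sub (hg i z) (hg j z)] at h1
    rw [dist_eq_norm] at h2 ⊢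
    rw [lt_div_iff₀ (by positivity)] at h2
    nlinarith [norm_nonneg (f i - f j)]
  have hder_pt : ∀ z, ∃ L, Tendsto (fun i => fderiv ℂ (g i) z) atTop (𝓝 L) := fun z =>
    cauchySeq_tendsto_of_complete ((hder (‖z‖ + 1)).cauchySeq (by simp))
  choose g' hg' using hder_pt
  refine ⟨g₀, fun z => ?_, ?_⟩
  · have hu : TendstoUniformlyOn (fun i z => fderiv ℂ (g i) z) g' atTop
        (Metric.ball (0 : Modes n) (‖z‖ + 1)) :=
      (hder _).tendstoUniformlyOn_of_tendsto fun w _ => hg' w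
    exact (hasFDerivAt_of_tendstoUniformlyOn Metric.isOpen_ball hu
      (fun i w _ => (hg i w).hasFDerivAt) (fun w _ => hg₀ w) (by simp)).differentiableAt
  · obtain ⟨ns, hns, hae⟩ := (tendstoInMeasure_of_tendsto_Lp hlim).exists_seq_tendsto_ae
    have hall : ∀ᵐ x ∂(gaussian n), ∀ i, f i x = g i x := ae_all_iff.2 hfg
    filter_upwards [hae, hall] with x h1 h2
    refine tendsto_nhds_unique h1 ?_
    simp only [h2]
    exact (hg₀ x).comp hns.tendsto_atTop

/-- The Fock space `F_{2,2,n}` in the Segal-Bargmann representation: the holomorphic functions on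
`ℂ^{4n}` that are square-integrable for the Gaussian measure, with the inner product of `L²`. -/
def Fock (n : ℕ) : Type := fockSubmodule n

instance normedAddCommGroup_fock (n : ℕ) : NormedAddCommGroup (Fock n) :=
  inferInstanceAs (NormedAddCommGroup (fockSubmodule n))

instance innerProductSpace_fock (n : ℕ) : InnerProductSpace ℂ (Fock n) :=
  inferInstanceAs (InnerProductSpace ℂ (fockSubmodule n))

instance completeSpace_fock (n : ℕ) : CompleteSpace (Fock n) :=
  (isClosed_fock n).completeSpace_coe

/-! ### Coherent states -/

/-- The domain `𝒟` of the complex `2 × 2` matrices `Λ` with `Λ Λ† < 1`. -/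
def domain : Set (Fin 2 → Fin 2 → ℂ) :=
  {Λ | (1 - Matrix.of Λ * (Matrix.of Λ).conjTranspose).PosDef}

/-- The domain `𝒟_η` of the complex `2 × 2` matrices `Λ` with `Λ Λ† ≤ η 1`. -/
def cutDomain (η : ℝ) : Set (Fin 2 → Fin 2 → ℂ) :=
  {Λ | ((η : ℂ) • 1 - Matrix.of Λ * (Matrix.of Λ).conjTranspose).PosSemidef}

/-- `det (1 - Λ Λ†)`, a positive real number for `Λ` in the domain. -/
def gap (Λ : Fin 2 → Fin 2 → ℂ) : ℝ :=
  (1 - Matrix.of Λ * (Matrix.of Λ).conjTranspose).det.re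

/-- The variables `Z_{i,j} = ∑ₖ z_{k,i} z'_{k,j}`. -/
def Z {n : ℕ} (p : Modes n) (i j : Fin 2) : ℂ := ∑ k, p.1 k i * p.2 k j

/-- The function `det (1 - Λ Λ†)^{n/2} exp (∑_{i,j} Λ_{i,j} Z_{i,j})`. -/
def cohFun (n : ℕ) (Λ : Fin 2 → Fin 2 → ℂ) (p : Modes n) : ℂ :=
  ((gap Λ ^ ((n : ℝ) / 2) : ℝ) : ℂ) * Complex.exp (∑ i, ∑ j, Λ i j * Z p i j)

lemma differentiable_cohFun (n : ℕ) (Λ : Fin 2 → Fin 2 → ℂ) : Differentiable ℂ (cohFun n Λ) := by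
  unfold cohFun Z; fun_prop

lemma strict_bound {Λ : Fin 2 → Fin 2 → ℂ} (hΛ : Λ ∈ domain) (x y : Fin 2 → ℂ)
    (hxy : (∑ i, ‖x i‖ ^ 2) + ∑ j, ‖y j‖ ^ 2 = 1) :
    2 * (∑ i, ∑ j, Λ i j * (x i * y j)).re < 1 := by
  by_cases hx : x = 0
  · simp [hx]
  have hx' : (star x) ≠ 0 := by simpa using hx
  have h1 := hΛ.re_dotProduct_pos hx'
  have h2 : (star (star x) ⬝ᵥ (1 - Matrix.of Λ * (Matrix.of Λ).conjTranspose).mulVec (star x)).re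
      = (∑ i, ‖x i‖ ^ 2) - ∑ j, ‖∑ i, Λ i j * x i‖ ^ 2 := by
    simp only [← Complex.normSq_eq_norm_sq]
    simp [Matrix.mulVec, dotProduct, Fin.sum_univ_two, Matrix.mul_apply, Complex.normSq_apply]
    ring
  have h3 : 0 < (∑ i, ‖x i‖ ^ 2) - ∑ j, ‖∑ i, Λ i j * x i‖ ^ 2 := by rw [← h2]; exact h1
  have h4 : 2 * (∑ i, ∑ j, Λ i j * (x i * y j)).re ≤
      (∑ j, ‖∑ i, Λ i j * x i‖ ^ 2) + ∑ j, ‖y j‖ ^ 2 := by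
    have h5 : ∀ a b : ℂ, 2 * (a * b).re ≤ ‖a‖ ^ 2 + ‖b‖ ^ 2 := fun a b => by
      have := Complex.re_le_norm (a * b)
      rw [norm_mul] at this
      nlinarith [sq_nonneg (‖a‖ - ‖b‖)]
    have h6 : ∑ i, ∑ j, Λ i j * (x i * y j) = ∑ j, (∑ i, Λ i j * x i) * y j := by
      simp only [Fin.sum_univ_two]; ring
    rw [h6, Complex.re_sum, Finset.mul_sum, ← Finset.sum_add_distrib]
    exact Finset.sum_le_sum fun j _ => h5 _ _
  linarith

lemma uniform_bound {Λ : Fin 2 → Fin 2 → ℂ} (hΛ : Λ ∈ domain) :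
    ∃ s < 1, ∀ x y : Fin 2 → ℂ, 2 * (∑ i, ∑ j, Λ i j * (x i * y j)).re ≤
      s * ((∑ i, ‖x i‖ ^ 2) + ∑ j, ‖y j‖ ^ 2) := by
  set q : (Fin 2 → ℂ) × (Fin 2 → ℂ) → ℝ := fun p => (∑ i, ‖p.1 i‖ ^ 2) + ∑ j, ‖p.2 j‖ ^ 2
  set b : (Fin 2 → ℂ) × (Fin 2 → ℂ) → ℝ := fun p => 2 * (∑ i, ∑ j, Λ i j * (p.1 i * p.2 j)).re
  have hq : Continuous q := by fun_prop
  have hb : Continuous b := by fun_prop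
  set S := q ⁻¹' {1}
  have hS : IsCompact S := by
    refine Metric.isCompact_of_isClosed_isBounded (isClosed_singleton.preimage hq) ?_
    refine (Metric.isBounded_closedBall (x := 0) (r := 1)).subset fun p hp => ?_
    have hp' : (∑ i, ‖p.1 i‖ ^ 2) + ∑ j, ‖p.2 j‖ ^ 2 = 1 := hp
    simp only [Fin.sum_univ_two] at hp'
    simp only [Metric.mem_closedBall, dist_zero_right, Prod.norm_def, sup_le_iff,
      pi_norm_le_iff_of_nonneg zero_le_one, Fin.forall_fin_two]
    refine ⟨⟨?_, ?_⟩, ?_, ?_⟩ <;>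
      nlinarith [sq_nonneg ‖p.1 0‖, sq_nonneg ‖p.1 1‖, sq_nonneg ‖p.2 0‖, sq_nonneg ‖p.2 1‖]
  have hne : S.Nonempty := ⟨(Pi.single 0 1, 0), by simp [S, q]⟩
  obtain ⟨p₀, hp₀, hmax⟩ := hS.exists_isMaxOn hne hb.continuousOn
  refine ⟨b p₀, strict_bound hΛ _ _ hp₀, fun x y => ?_⟩
  have hnn : 0 ≤ q (x, y) := by positivity
  rcases hnn.eq_or_lt with h0 | hpos
  · have hq0 : (∑ i, ‖x i‖ ^ 2) + ∑ j, ‖y j‖ ^ 2 = 0 := h0.symm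
    have hx : x = 0 := by
      have h1 : ∑ i, ‖x i‖ ^ 2 = 0 := by
        have : 0 ≤ ∑ j, ‖y j‖ ^ 2 := by positivity
        have : 0 ≤ ∑ i, ‖x i‖ ^ 2 := by positivity
        linarith
      rw [Finset.sum_eq_zero_iff_of_nonneg (fun _ _ => by positivity)] at h1
      ext i; simpa using h1 i (Finset.mem_univ i)
    rw [hq0]; simp [hx]
  · set r : ℝ := (Real.sqrt (q (x, y)))⁻¹
    have hr : r ^ 2 = (q (x, y))⁻¹ := by simp [r, inv_pow, Real.sq_sqrt hnn]
    have hscale_q : q ((r : ℂ) • x, (r : ℂ) • y) = r ^ 2 * q (x, y) := by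
      simp only [q, Pi.smul_apply, smul_eq_mul, norm_mul, mul_pow, Complex.norm_real,
        Real.norm_eq_abs, sq_abs, Finset.mul_sum, mul_add]
    have hscale_b : b ((r : ℂ) • x, (r : ℂ) • y) = r ^ 2 * b (x, y) := by
      have : (∑ i, ∑ j, Λ i j * (((r : ℂ) • x) i * ((r : ℂ) • y) j)) =
          ((r ^ 2 : ℝ) : ℂ) * ∑ i, ∑ j, Λ i j * (x i * y j) := by
        simp only [Fin.sum_univ_two, Pi.smul_apply, smul_eq_mul]; push_cast; ring
      simp only [b, this, Complex.re_ofReal_mul]; ring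
    have hmem : ((r : ℂ) • x, (r : ℂ) • y) ∈ S := by
      simp only [S, Set.mem_preimage, Set.mem_singleton_iff]
      rw [hscale_q, hr, inv_mul_cancel₀ hpos.ne']
    have h1 : b ((r : ℂ) • x, (r : ℂ) • y) ≤ b p₀ := hmax hmem
    rw [hscale_b, hr, inv_mul_le_iff₀ hpos] at h1
    change b (x, y) ≤ b p₀ * q (x, y)
    linarith

lemma memLp_cohFun (n : ℕ) {Λ : Fin 2 → Fin 2 → ℂ} (hΛ : Λ ∈ domain) :
    MemLp (cohFun n Λ) 2 (gaussian n) := by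
  have hc := (differentiable_cohFun n Λ).continuous
  obtain ⟨s, hs, hb⟩ := uniform_bound hΛ
  have hsq := continuous_sqNorm n
  rw [memLp_two_iff_integrable_sq_norm hc.aestronglyMeasurable, gaussian,
    integrable_withDensity_iff (by fun_prop) (by simp)]
  have h := (integrable_exp_neg_sqNorm n (sub_pos.2 hs)).const_mul
    ((gap Λ ^ ((n : ℝ) / 2)) ^ 2 * (Real.pi ^ (4 * n))⁻¹)
  refine h.mono' (Continuous.aestronglyMeasurable ?_) (Eventually.of_forall fun p => ?_)
  · simp only [ENNReal.toReal_ofReal (density_pos _).le]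
    fun_prop
  rw [ENNReal.toReal_ofReal (density_pos _).le, Real.norm_of_nonneg (by positivity)]
  have h1 : ‖cohFun n Λ p‖ ^ 2 = (gap Λ ^ ((n : ℝ) / 2)) ^ 2 *
      Real.exp (2 * (∑ i, ∑ j, Λ i j * Z p i j).re) := by
    rw [cohFun, norm_mul, mul_pow, Complex.norm_real, Real.norm_eq_abs, sq_abs, Complex.norm_exp,
      ← Real.exp_nat_mul]
    norm_num
  have h2 : 2 * (∑ i, ∑ j, Λ i j * Z p i j).re ≤ s * sqNorm p := by
    have h3 : ∑ i, ∑ j, Λ i j * Z p i j = ∑ k, ∑ i, ∑ j, Λ i j * (p.1 k i * p.2 k j) := by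
      simp only [Z, Fin.sum_univ_two, Finset.mul_sum, Finset.sum_add_distrib]
    rw [h3, Complex.re_sum, Finset.mul_sum, sqNorm, ← Finset.sum_add_distrib, Finset.mul_sum]
    exact Finset.sum_le_sum fun k _ => hb _ _
  rw [h1]
  calc _ = (gap Λ ^ ((n : ℝ) / 2)) ^ 2 * (Real.pi ^ (4 * n))⁻¹ *
        Real.exp (2 * (∑ i, ∑ j, Λ i j * Z p i j).re + -sqNorm p) := by rw [Real.exp_add]; ring
    _ ≤ _ := by
      gcongr
      linarith

open Classical in
/-- The coherent state `|Λ, n⟩` for `Λ` in the domain (and `0` elsewhere). -/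
def coherent (n : ℕ) (Λ : Fin 2 → Fin 2 → ℂ) : Fock n :=
  if h : Λ ∈ domain then
    (⟨(memLp_cohFun n h).toLp, cohFun n Λ, differentiable_cohFun n Λ,
      (memLp_cohFun n h).coeFn_toLp⟩ : fockSubmodule n)
  else 0

/-- The invariant measure
`dμ_n = (n-1)(n-2)²(n-3) / (π⁴ det (1 - Λ Λ†)⁴) ∏_{i,j} d(Re Λ_{i,j}) d(Im Λ_{i,j})` on the
domain. -/
def invMeasure (n : ℕ) : Measure (Fin 2 → Fin 2 → ℂ) :=
  (volume.restrict domain).withDensity fun Λ => ENNReal.ofReal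
    (((n : ℝ) - 1) * ((n : ℝ) - 2) ^ 2 * ((n : ℝ) - 3) / (Real.pi ^ 4 * gap Λ ^ 4))

/-- The projector `|Λ, n⟩⟨Λ, n|`. -/
def projector (n : ℕ) (Λ : Fin 2 → Fin 2 → ℂ) : Fock n →L[ℂ] Fock n :=
  InnerProductSpace.rankOne ℂ (coherent n Λ) (coherent n Λ)

/-- The operator `∫_{𝒟_η} |Λ, n⟩⟨Λ, n| dμ_n(Λ)`, as a Bochner integral for the operator norm; where
the integrand is integrable this is also the integral in the weak operator topology. -/
def cutOperator (n : ℕ) (η : ℝ) : Fock n →L[ℂ] Fock n :=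
  ∫ Λ in cutDomain η, projector n Λ ∂(invMeasure n)

/-! ### The trace -/

section Trace

variable {H : Type*} [NormedAddCommGroup H] [InnerProductSpace ℂ H] [CompleteSpace H]

/-- A bounded operator `A` is of trace class if `∑ᵢ ⟨eᵢ, |A| eᵢ⟩ < ∞` for every orthonormal basis,
where `|A| = (A† A)^{1/2}`. -/
def IsTraceClass (A : H →L[ℂ] H) : Prop :=
  ∀ (w : Set H) (b : HilbertBasis w ℂ H), Summable fun i => inner ℂ (b i) (CFC.abs A (b i))

/-- `A` has trace `t`: for every orthonormal basis, `∑ᵢ ⟨eᵢ, A eᵢ⟩ = t`. -/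
def HasTrace (A : H →L[ℂ] H) (t : ℂ) : Prop :=
  ∀ (w : Set H) (b : HilbertBasis w ℂ H), HasSum (fun i => inner ℂ (b i) (A (b i))) t

end Trace

end SU22
end

noncomputable section

namespace SU22

/-! ### Integration over `2 × 2` complex matrices in singular coordinates -/

/-! The coherent states are unit vectors, so the trace of an integral of their projectors is the
total mass of the measure: for an orthonormal basis `b`, the diagonal entry at `b i` is the integral
of `|⟨b i, ψ⟩|²`, and by Parseval these integrands sum to `1`. The integral is a positive operator,
so it equals its own absolute value and its finite trace makes it trace class
(`hasTrace_integral_rankOne`, `isTraceClass_integral_rankOne`). Bochner integrability follows from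
norm one, finite mass and norm continuity of the states on the domain (`continuousOn_coherent`).

The unit norm is a Gaussian computation (`integral_norm_sq_cohFun`): integrating out `z'` leaves,
for each of the `n` indices `k`, a Gaussian in two complex variables whose form has determinant `det
(1 - Λ Λ†)`; the resulting power `-n` cancels the normalization.

The mass is computed by `setLIntegral_cutDomain`. Both the density and the cut domain depend only on
the squared norms of the two rows and on `|det Λ|²`. Let `x` be the squared norm of the first row,
and `w`, `y` the squared norms of the components of the second row along and orthogonal to the
first, up to conjugation. Then `|det Λ|² = x y`, and Lebesgue measure becomes `π⁴ x dx dy dw`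
(`lintegral_matrix`). The gap is `(1 - x)(1 - y) - w`, the cut domain is `x, y ≤ η`, `w ≤ (η - x)(η
- y) / η`, and three elementary integrals give `η⁴ / (12 (1 - η)⁴)`.

For the bounds, put `m = n - 5`. Then `η / (1 - η) = (K - m) / (2 m)`, and `m ≥ 33` leaves enough
room below `K⁴ / 100` to absorb the extra `1`. -/

/-- A disc of radius `√t` has area `π t`, and values on half-open intervals determine the measure.
-/
lemma map_normSq_volume :
    (volume : Measure ℂ).map normSq =
      ENNReal.ofReal Real.pi • (volume : Measure ℝ).restrict (Set.Ioi 0) := by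
  have hIic : ∀ t : ℝ, (volume : Measure ℂ) (normSq ⁻¹' Set.Iic t) =
      ENNReal.ofReal Real.pi * ENNReal.ofReal t := by
    intro t
    rcases lt_or_ge t 0 with ht | ht
    · have : (normSq ⁻¹' Set.Iic t : Set ℂ) = ∅ := by
        ext z
        simpa using ht.trans_le (normSq_nonneg z)
      simp [this, ENNReal.ofReal_of_nonpos ht.le]
    · have : (normSq ⁻¹' Set.Iic t : Set ℂ) = Metric.closedBall 0 (Real.sqrt t) := by
        ext z
        simp [normSq_eq_norm_sq, Real.le_sqrt (norm_nonneg z) ht]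
      rw [this, Complex.volume_closedBall, ← ENNReal.ofReal_pow (Real.sqrt_nonneg t),
        Real.sq_sqrt ht, mul_comm]
      congr 1
      exact (ENNReal.ofReal_eq_coe_nnreal Real.pi_pos.le).symm
  have hm : Measurable (normSq : ℂ → ℝ) := continuous_normSq.measurable
  refine (Measure.ext_of_Ioc' _ _ ?_ ?_).symm
  · intro a b _
    simp only [Measure.smul_apply, smul_eq_mul]
    exact ENNReal.mul_ne_top ENNReal.ofReal_ne_top
      ((Measure.restrict_apply_le _ _).trans_lt (by simp)).ne
  · intro a b hab
    have hd : Set.Ioc a b = Set.Iic b \ Set.Iic a := by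
      ext x; simp [and_comm]
    rw [Measure.map_apply hm measurableSet_Ioc, hd, Set.preimage_sdiff,
      measure_sdiff (Set.preimage_mono (Set.Iic_subset_Iic.2 hab.le))
        (hm measurableSet_Iic).nullMeasurableSet
        (by rw [hIic]; exact ENNReal.mul_ne_top ENNReal.ofReal_ne_top ENNReal.ofReal_ne_top),
      hIic, hIic, Measure.smul_apply, smul_eq_mul, ← hd,
      Measure.restrict_apply measurableSet_Ioc, Set.Ioc_inter_Ioi, Real.volume_Ioc,
      ← ENNReal.mul_sub (fun _ _ => ENNReal.ofReal_ne_top)]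
    congr 1
    rcases le_total a 0 with ha | ha
    · simp [ha, ENNReal.ofReal_of_nonpos ha]
    · simp [ha, ENNReal.ofReal_sub]

lemma lintegral_normSq {f : ℝ → ℝ≥0∞} (hf : Measurable f) :
    ∫⁻ z : ℂ, f (normSq z) = ENNReal.ofReal Real.pi * ∫⁻ w in Set.Ioi 0, f w := by
  rw [← lintegral_map hf continuous_normSq.measurable, map_normSq_volume, lintegral_smul_measure,
    smul_eq_mul]

/-- The weight `x` is the convolution of Lebesgue measure on the half-line with itself: the
splittings `x = s + t` with `s, t > 0` form a segment of length `x`. -/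
lemma lintegral_normSq_add {f : ℝ → ℝ≥0∞} (hf : Measurable f) :
    ∫⁻ p : ℂ × ℂ, f (normSq p.1 + normSq p.2) =
      ENNReal.ofReal Real.pi ^ 2 * ∫⁻ x in Set.Ioi 0, ENNReal.ofReal x * f x := by
  have hm : Measurable (normSq : ℂ → ℝ) := continuous_normSq.measurable
  rw [Measure.volume_eq_prod, lintegral_prod _ (by fun_prop)]
  have h1 : ∀ a : ℂ, ∫⁻ b : ℂ, f (normSq a + normSq b) =
      ENNReal.ofReal Real.pi * ∫⁻ x in Set.Ioi 0, (Set.Ioi (normSq a)).indicator f x := by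
    intro a
    rw [lintegral_normSq (f := fun t => f (normSq a + t)) (by fun_prop)]
    congr 1
    -- Translation by `normSq a` turns the second squared modulus into the sum itself, which ranges
    -- above `normSq a`.
    rw [setLIntegral_indicator measurableSet_Ioi, Set.Ioi_inter_Ioi,
      sup_of_le_left (normSq_nonneg a), ← lintegral_indicator measurableSet_Ioi,
      ← lintegral_indicator measurableSet_Ioi,
      ← lintegral_add_left_eq_self ((Set.Ioi (normSq a)).indicator f) (normSq a)]
    congr 1
    ext x
    simp [Set.indicator]
  have hind : Measurable fun q : ℝ × ℝ => (Set.Ioi q.1).indicator f q.2 := by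
    have : (fun q : ℝ × ℝ => (Set.Ioi q.1).indicator f q.2) =
        {q : ℝ × ℝ | q.1 < q.2}.indicator fun q => f q.2 := by
      ext q; simp [Set.indicator]
    rw [this]
    exact (by fun_prop : Measurable fun q : ℝ × ℝ => f q.2).indicator
      (measurableSet_lt measurable_fst measurable_snd)
  simp only [h1]
  rw [lintegral_normSq (f := fun s => ENNReal.ofReal Real.pi *
      ∫⁻ x in Set.Ioi 0, (Set.Ioi s).indicator f x)
      (Measurable.const_mul (Measurable.lintegral_prod_right' hind) _),
    lintegral_const_mul _ (Measurable.lintegral_prod_right' hind), ← mul_assoc, ← sq,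
    lintegral_lintegral_swap hind.aemeasurable]
  congr 1
  refine setLIntegral_congr_fun measurableSet_Ioi fun x _ => ?_
  have h2 : ∀ s : ℝ, (Set.Ioi s).indicator f x = (Set.Iio x).indicator (fun _ => f x) s := by
    intro s; simp [Set.indicator]
  simp only [h2]
  rw [lintegral_indicator measurableSet_Iio, lintegral_const, Measure.restrict_restrict
    measurableSet_Iio, Measure.restrict_apply_univ, Set.inter_comm, Set.Ioi_inter_Iio,
    Real.volume_Ioo, sub_zero, mul_comm]

/-- The complex linear map of `ℂ²` with matrix `!![p, q; r, s]`. -/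
def linMap (p q r s : ℂ) : ℂ × ℂ →ₗ[ℂ] ℂ × ℂ :=
  (p • LinearMap.fst ℂ ℂ ℂ + q • LinearMap.snd ℂ ℂ ℂ).prod
    (r • LinearMap.fst ℂ ℂ ℂ + s • LinearMap.snd ℂ ℂ ℂ)

lemma linMap_apply (p q r s : ℂ) (v : ℂ × ℂ) :
    linMap p q r s v = (p * v.1 + q * v.2, r * v.1 + s * v.2) := by
  simp [linMap]

lemma det_linMap (p q r s : ℂ) : LinearMap.det (linMap p q r s) = p * s - q * r := by
  have : LinearMap.toMatrix (Module.Basis.finTwoProd ℂ) (Module.Basis.finTwoProd ℂ)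
      (linMap p q r s) =
      !![p, q; r, s] := by
    ext i j
    fin_cases i <;> fin_cases j <;> simp [LinearMap.toMatrix_apply, linMap_apply]
  rw [← LinearMap.det_toMatrix (Module.Basis.finTwoProd ℂ), this, Matrix.det_fin_two_of]

/-- The real determinant of a complex linear map is the squared modulus of its complex determinant.
-/
lemma measurePreserving_linMap {p q r s : ℂ} (h : normSq (p * s - q * r) = 1) :
    MeasurePreserving (linMap p q r s) := by
  have hdet : LinearMap.det ((linMap p q r s).restrictScalars ℝ) = 1 := by
    rw [LinearMap.det_restrictScalars, det_linMap, Algebra.norm_complex_apply, h]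
  refine ⟨?_, ?_⟩
  · have : Continuous (linMap p q r s) := LinearMap.continuous_of_finiteDimensional _
    exact this.measurable
  · have : (volume : Measure (ℂ × ℂ)).IsAddHaarMeasure := Measure.prod.instIsAddHaarMeasure _ _
    have h := Measure.map_linearMap_addHaar_eq_smul_addHaar (volume : Measure (ℂ × ℂ))
      (f := (linMap p q r s).restrictScalars ℝ) (by rw [hdet]; exact one_ne_zero)
    rw [hdet] at h
    simpa using h

/-- For a given first row, a unitary change of the second row turns the matrix into a lower
triangular one. -/
lemma exists_rotation (a b : ℂ) : ∃ e : ℂ × ℂ → ℂ × ℂ, MeasurePreserving e ∧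
    ∀ v, normSq (e v).1 + normSq (e v).2 = normSq v.1 + normSq v.2 ∧
      (normSq a + normSq b) * normSq (e v).2 = normSq (a * v.2 - b * v.1) := by
  rcases (add_nonneg (normSq_nonneg a) (normSq_nonneg b)).eq_or_lt' with h0 | hpos
  · have ha : a = 0 := by
      rw [← normSq_eq_zero]; linarith [normSq_nonneg a, normSq_nonneg b]
    have hb : b = 0 := by
      rw [← normSq_eq_zero]; linarith [normSq_nonneg a, normSq_nonneg b]
    exact ⟨id, MeasurePreserving.id _, fun v => by simp [ha, hb]⟩
  · set t : ℝ := (Real.sqrt (normSq a + normSq b))⁻¹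
    have ht : t * t = (normSq a + normSq b)⁻¹ := by
      rw [← mul_inv, Real.mul_self_sqrt hpos.le]
    have ht' : t * t * (normSq a + normSq b) = 1 := by rw [ht]; exact inv_mul_cancel₀ hpos.ne'
    simp only [normSq_apply] at ht'
    -- This matrix is unitary, and its second row sends `v` to `t (a v₂ - b v₁)`, the determinant
    -- divided by the norm of `(a, b)`.
    refine ⟨linMap (t * conj a) (t * conj b) (-(t * b)) (t * a), measurePreserving_linMap ?_,
      fun v => ⟨?_, ?_⟩⟩
    · have : (t : ℂ) * conj a * (t * a) - t * conj b * -(t * b) = 1 := by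
        apply Complex.ext
        · simp; linear_combination ht'
        · simp; ring
      rw [this]; simp
    · simp only [linMap_apply, normSq_apply]
      simp
      linear_combination (v.1.re ^ 2 + v.1.im ^ 2 + v.2.re ^ 2 + v.2.im ^ 2) * ht'
    · simp only [linMap_apply, normSq_apply]
      simp
      linear_combination ((a.re * v.2.re - a.im * v.2.im - (b.re * v.1.re - b.im * v.1.im)) ^ 2 +
        (a.re * v.2.im + a.im * v.2.re - (b.re * v.1.im + b.im * v.1.re)) ^ 2) * ht'

/-- A function of the squared norms of the rows and of the squared modulus of the determinant is
integrated over the `2 × 2` complex matrices. -/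
lemma lintegral_matrix {G : ℝ × ℝ × ℝ → ℝ≥0∞} (hG : Measurable G) :
    ∫⁻ Λ : Fin 2 → Fin 2 → ℂ, G (normSq (Λ 0 0) + normSq (Λ 0 1),
      normSq (Λ 1 0) + normSq (Λ 1 1), normSq (Λ 0 0 * Λ 1 1 - Λ 0 1 * Λ 1 0)) =
    ENNReal.ofReal Real.pi ^ 4 * ∫⁻ x in Set.Ioi 0, ENNReal.ofReal x *
      ∫⁻ y in Set.Ioi 0, ∫⁻ w in Set.Ioi 0, G (x, w + y, x * y) := by
  have hm : Measurable (normSq : ℂ → ℝ) := continuous_normSq.measurable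
  have e1 := volume_preserving_finTwoArrow (Fin 2 → ℂ)
  have e2 := volume_preserving_finTwoArrow ℂ
  set g : (ℂ × ℂ) × (ℂ × ℂ) → ℝ≥0∞ := fun p => G (normSq p.1.1 + normSq p.1.2,
    normSq p.2.1 + normSq p.2.2, normSq (p.1.1 * p.2.2 - p.1.2 * p.2.1)) with hg
  have hgm : Measurable g := by fun_prop
  have h1 : ∫⁻ Λ : Fin 2 → Fin 2 → ℂ, G (normSq (Λ 0 0) + normSq (Λ 0 1),
      normSq (Λ 1 0) + normSq (Λ 1 1), normSq (Λ 0 0 * Λ 1 1 - Λ 0 1 * Λ 1 0)) =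
      ∫⁻ p, g p :=
    ((e2.prod e2).comp e1).lintegral_comp hgm
  have hin : Measurable fun q : ℝ × ℝ => ∫⁻ w in Set.Ioi 0, G (q.1, w + q.2, q.1 * q.2) :=
    Measurable.lintegral_prod_right' (f := fun u : (ℝ × ℝ) × ℝ => G (u.1.1, u.2 + u.1.2,
      u.1.1 * u.1.2)) (by fun_prop)
  have hin2 : Measurable fun x : ℝ => ∫⁻ y in Set.Ioi 0, ∫⁻ w in Set.Ioi 0, G (x, w + y, x * y) :=
    Measurable.lintegral_prod_right' hin
  rw [h1, Measure.volume_eq_prod, lintegral_prod _ hgm.aemeasurable]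
  have h2 : ∀ r : ℂ × ℂ, ∫⁻ v : ℂ × ℂ, g (r, v) = ENNReal.ofReal Real.pi ^ 2 *
      ∫⁻ y in Set.Ioi 0, ∫⁻ w in Set.Ioi 0, G (normSq r.1 + normSq r.2, w + y,
        (normSq r.1 + normSq r.2) * y) := by
    intro r
    -- After the rotation the second coordinate alone carries the determinant: its squared modulus
    -- becomes `y`, that of the first coordinate `w`.
    obtain ⟨e, he, hv⟩ := exists_rotation r.1 r.2
    set φ : ℂ × ℂ → ℝ≥0∞ := fun u => G (normSq r.1 + normSq r.2,
      normSq u.1 + normSq u.2, (normSq r.1 + normSq r.2) * normSq u.2)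
    have hφ : Measurable φ := by fun_prop
    have h3 : ∀ v, g (r, v) = φ (e v) := by
      intro v
      simp only [hg, φ, ← (hv v).1, ← (hv v).2]
    rw [lintegral_congr h3, he.lintegral_comp hφ, Measure.volume_eq_prod,
      lintegral_prod_symm _ hφ.aemeasurable]
    have h4 : ∀ q : ℂ, ∫⁻ p : ℂ, G (normSq r.1 + normSq r.2, normSq p + normSq q,
        (normSq r.1 + normSq r.2) * normSq q) = ENNReal.ofReal Real.pi * ∫⁻ w in Set.Ioi 0,
        G (normSq r.1 + normSq r.2, w + normSq q, (normSq r.1 + normSq r.2) * normSq q) := by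
      intro q
      exact lintegral_normSq (f := fun w => G (normSq r.1 + normSq r.2, w + normSq q,
        (normSq r.1 + normSq r.2) * normSq q)) (by fun_prop)
    simp only [φ, h4]
    have h5 : Measurable fun y : ℝ => ∫⁻ w in Set.Ioi 0, G (normSq r.1 + normSq r.2, w + y,
        (normSq r.1 + normSq r.2) * y) := hin.comp (by fun_prop :
          Measurable fun y : ℝ => (normSq r.1 + normSq r.2, y))
    rw [lintegral_normSq (f := fun y => ENNReal.ofReal Real.pi * ∫⁻ w in Set.Ioi 0,
      G (normSq r.1 + normSq r.2, w + y, (normSq r.1 + normSq r.2) * y)) (h5.const_mul _),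
      lintegral_const_mul _ h5, ← mul_assoc, ← sq]
  simp only [h2]
  rw [lintegral_normSq_add (f := fun x => ENNReal.ofReal Real.pi ^ 2 *
      ∫⁻ y in Set.Ioi 0, ∫⁻ w in Set.Ioi 0, G (x, w + y, x * y)) (hin2.const_mul _),
    ← lintegral_const_mul _ (by fun_prop), ← lintegral_const_mul _ (by fun_prop)]
  refine lintegral_congr fun x => ?_
  ring

/-! ### The domains in coordinates -/

lemma gap_eq (Λ : Fin 2 → Fin 2 → ℂ) :
    gap Λ = 1 - (normSq (Λ 0 0) + normSq (Λ 0 1)) - (normSq (Λ 1 0) + normSq (Λ 1 1)) +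
      normSq (Λ 0 0 * Λ 1 1 - Λ 0 1 * Λ 1 0) := by
  simp [gap, Matrix.det_fin_two, Matrix.mul_apply, Fin.sum_univ_two, normSq_apply]
  ring

lemma quadForm_eq (η : ℝ) (Λ : Fin 2 → Fin 2 → ℂ) (x : Fin 2 → ℂ) :
    star x ⬝ᵥ ((η : ℂ) • 1 - Matrix.of Λ * (Matrix.of Λ).conjTranspose).mulVec x =
      (((η - (normSq (Λ 0 0) + normSq (Λ 0 1))) * normSq (x 0) +
        (η - (normSq (Λ 1 0) + normSq (Λ 1 1))) * normSq (x 1) -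
        2 * ((Λ 0 0 * conj (Λ 1 0) + Λ 0 1 * conj (Λ 1 1)) * x 1 * conj (x 0)).re : ℝ) : ℂ) := by
  apply Complex.ext
  · simp [Matrix.mulVec, dotProduct, Fin.sum_univ_two, Matrix.mul_apply, normSq_apply]
    ring
  · simp [Matrix.mulVec, dotProduct, Fin.sum_univ_two, Matrix.mul_apply, normSq_apply]
    ring

lemma isHermitian_sub (η : ℝ) (Λ : Fin 2 → Fin 2 → ℂ) :
    ((η : ℂ) • 1 - Matrix.of Λ * (Matrix.of Λ).conjTranspose).IsHermitian := by
  refine Matrix.IsHermitian.sub ?_ (Matrix.isHermitian_mul_conjTranspose_self _)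
  simp [Matrix.IsHermitian, Matrix.conjTranspose_smul]

/-- Lagrange's identity: the Gram determinant of the two rows is `|det|²`. -/
lemma normSq_rows (a b c d : ℂ) :
    normSq (a * conj c + b * conj d) + normSq (a * d - b * c) =
      (normSq a + normSq b) * (normSq c + normSq d) := by
  simp [normSq_apply]
  ring

/-- Multiply by `p` and complete the square; if `p = 0` the determinant condition kills the cross
term. -/
lemma quadForm_nonneg {p r : ℝ} {q : ℂ} (hp : 0 ≤ p) (hr : 0 ≤ r) (h : normSq q ≤ p * r) (x y : ℂ) :
    0 ≤ p * normSq x + r * normSq y - 2 * (q * y * conj x).re := by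
  rcases hp.eq_or_lt with rfl | hp
  · have hq : q = 0 := by
      rw [← normSq_eq_zero]; linarith [normSq_nonneg q]
    simp [hq]
    exact mul_nonneg hr (normSq_nonneg y)
  · have h1 : p * (p * normSq x + r * normSq y - 2 * (q * y * conj x).re) =
        normSq (p * x - q * y) + (p * r - normSq q) * normSq y := by
      simp [normSq_apply]
      ring
    have h2 : 0 ≤ p * (p * normSq x + r * normSq y - 2 * (q * y * conj x).re) := by
      rw [h1]
      exact add_nonneg (normSq_nonneg _) (mul_nonneg (sub_nonneg.2 h) (normSq_nonneg y))
    exact nonneg_of_mul_nonneg_right h2 hp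

/-- A Hermitian `2 × 2` matrix is positive semidefinite exactly when its diagonal entries and
determinant are nonnegative. This expresses the domain in the three quantities used by
`lintegral_matrix`. -/
lemma mem_cutDomain_iff {η : ℝ} {Λ : Fin 2 → Fin 2 → ℂ} :
    Λ ∈ cutDomain η ↔ normSq (Λ 0 0) + normSq (Λ 0 1) ≤ η ∧
      normSq (Λ 1 0) + normSq (Λ 1 1) ≤ η ∧
      0 ≤ η ^ 2 - η * (normSq (Λ 0 0) + normSq (Λ 0 1) + (normSq (Λ 1 0) + normSq (Λ 1 1))) +
        normSq (Λ 0 0 * Λ 1 1 - Λ 0 1 * Λ 1 0) := by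
  have hrows := normSq_rows (Λ 0 0) (Λ 0 1) (Λ 1 0) (Λ 1 1)
  set s := normSq (Λ 0 0) + normSq (Λ 0 1) with hs
  set t := normSq (Λ 1 0) + normSq (Λ 1 1) with ht
  constructor
  · intro h
    have h' : ((η : ℂ) • 1 - Matrix.of Λ * (Matrix.of Λ).conjTranspose).PosSemidef := h
    have hd := h'.det_nonneg
    have h0 := h'.diag_nonneg (i := 0)
    have h1 := h'.diag_nonneg (i := 1)
    rw [Complex.nonneg_iff] at hd h0 h1
    refine ⟨?_, ?_, ?_⟩
    · have := h0.1
      simp [Matrix.mul_apply, Fin.sum_univ_two] at this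
      simp only [hs, normSq_apply]; linarith
    · have := h1.1
      simp [Matrix.mul_apply, Fin.sum_univ_two] at this
      simp only [ht, normSq_apply]; linarith
    · refine hd.1.trans_eq ?_
      simp [hs, ht, Matrix.det_fin_two, Matrix.mul_apply, Fin.sum_univ_two, normSq_apply]
      ring
  · rintro ⟨h0, h1, hd⟩
    refine Matrix.PosSemidef.of_dotProduct_mulVec_nonneg (isHermitian_sub η Λ) fun x => ?_
    rw [quadForm_eq]
    exact_mod_cast quadForm_nonneg (sub_nonneg.2 h0) (sub_nonneg.2 h1) (by nlinarith) _ _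

lemma cutDomain_subset_domain {η : ℝ} (hη : η < 1) : cutDomain η ⊆ domain := by
  intro Λ h
  have h1 : (((1 - η : ℝ) : ℂ) • (1 : Matrix (Fin 2) (Fin 2) ℂ)).PosDef :=
    Matrix.PosDef.one.smul (by exact_mod_cast sub_pos.2 hη)
  have h2 := h1.add_posSemidef h
  have h3 : ((1 - η : ℝ) : ℂ) • (1 : Matrix (Fin 2) (Fin 2) ℂ) +
      ((η : ℂ) • 1 - Matrix.of Λ * (Matrix.of Λ).conjTranspose) =
      1 - Matrix.of Λ * (Matrix.of Λ).conjTranspose := by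
    push_cast
    module
  rw [h3] at h2
  exact h2

lemma gap_pos {Λ : Fin 2 → Fin 2 → ℂ} (hΛ : Λ ∈ domain) : 0 < gap Λ :=
  (Complex.pos_iff.1 (Matrix.PosDef.det_pos hΛ)).1

lemma continuous_gap : Continuous gap := by
  have h := continuous_normSq
  rw [funext gap_eq]
  fun_prop

lemma measurableSet_cutDomain (η : ℝ) : MeasurableSet (cutDomain η) := by
  have h := continuous_normSq
  have : cutDomain η = {Λ | normSq (Λ 0 0) + normSq (Λ 0 1) ≤ η} ∩
      ({Λ | normSq (Λ 1 0) + normSq (Λ 1 1) ≤ η} ∩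
      {Λ | 0 ≤ η ^ 2 - η * (normSq (Λ 0 0) + normSq (Λ 0 1) + (normSq (Λ 1 0) + normSq (Λ 1 1))) +
        normSq (Λ 0 0 * Λ 1 1 - Λ 0 1 * Λ 1 0)}) := by
    ext Λ; exact mem_cutDomain_iff
  rw [this]
  refine (IsClosed.inter ?_ (IsClosed.inter ?_ ?_)).measurableSet
  · exact isClosed_le (by fun_prop) continuous_const
  · exact isClosed_le (by fun_prop) continuous_const
  · exact isClosed_le continuous_const (by fun_prop)

/-! ### The volume of the cut domain -/

lemma lintegral_Ioc_of_hasDerivAt {F f : ℝ → ℝ} {a b : ℝ} (hab : a ≤ b)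
    (hF : ∀ x ∈ Set.Icc a b, HasDerivAt F (f x) x) (hf : ContinuousOn f (Set.Icc a b))
    (h0 : ∀ x ∈ Set.Icc a b, 0 ≤ f x) :
    ∫⁻ x in Set.Ioc a b, ENNReal.ofReal (f x) = ENNReal.ofReal (F b - F a) := by
  have hi : IntervalIntegrable f volume a b := by
    apply ContinuousOn.intervalIntegrable
    rwa [Set.uIcc_of_le hab]
  rw [← intervalIntegral.integral_eq_sub_of_hasDerivAt (by rwa [Set.uIcc_of_le hab]) hi,
    intervalIntegral.integral_of_le hab, ofReal_integral_eq_lintegral_ofReal]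
  · exact (intervalIntegrable_iff_integrableOn_Ioc_of_le hab).1 hi
  · exact (ae_restrict_iff' measurableSet_Ioc).2
      (Eventually.of_forall fun x hx => h0 x (Set.Ioc_subset_Icc_self hx))

section Radial

variable {η : ℝ}

/-- The left side is the gap at the largest admissible `w`; the factored form shows that it stays
positive. -/
lemma one_sub_mul_one_sub (h0 : 0 < η) (x y : ℝ) :
    (1 - x) * (1 - y) - (η - x) * (η - y) / η = (1 - η) * (1 - x * y / η) := by
  field_simp
  ring

lemma lintegral_radial_perp (h0 : 0 < η) (h1 : η < 1) {x y : ℝ} (hx : x ∈ Set.Ioc 0 η)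
    (hy : y ∈ Set.Ioc 0 η) :
    ∫⁻ w in Set.Ioc 0 ((η - x) * (η - y) / η),
      ENNReal.ofReal (1 / ((1 - x) * (1 - y) - w) ^ 4) =
    ENNReal.ofReal (1 / (3 * ((1 - η) * (1 - x * y / η)) ^ 3) -
      1 / (3 * ((1 - x) * (1 - y)) ^ 3)) := by
  have hB : 0 ≤ (η - x) * (η - y) / η :=
    div_nonneg (mul_nonneg (sub_nonneg.2 hx.2) (sub_nonneg.2 hy.2)) h0.le
  have hpos : ∀ w ∈ Set.Icc 0 ((η - x) * (η - y) / η), 0 < (1 - x) * (1 - y) - w := by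
    intro w hw
    have h2 : x * y / η < 1 := by
      rw [div_lt_one h0]
      nlinarith [hx.1, hx.2, hy.1, hy.2]
    have h3 : 0 < (1 - η) * (1 - x * y / η) := mul_pos (by linarith) (by linarith)
    rw [← one_sub_mul_one_sub h0] at h3
    linarith [hw.2]
  rw [lintegral_Ioc_of_hasDerivAt (F := fun w => 1 / (3 * ((1 - x) * (1 - y) - w) ^ 3)) hB]
  · rw [one_sub_mul_one_sub h0, sub_zero]
  · intro w hw
    have h := (hpos w hw).ne'
    have hd : HasDerivAt (fun w => 3 * ((1 - x) * (1 - y) - w) ^ 3)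
        (3 * (3 * ((1 - x) * (1 - y) - w) ^ 2 * -1)) w := by
      simpa using (((hasDerivAt_id w).const_sub ((1 - x) * (1 - y))).fun_pow 3).const_mul 3
    have hd' := hd.fun_inv (by positivity)
    simp only [one_div]
    refine hd'.congr_deriv ?_
    generalize (1 - x) * (1 - y) - w = u at h
    field_simp
  · refine ContinuousOn.div continuousOn_const (by fun_prop) fun w hw => ?_
    exact pow_ne_zero _ (hpos w hw).ne'
  · intro w hw
    positivity

lemma lintegral_radial_snd (h0 : 0 < η) (h1 : η < 1) {x : ℝ} (hx : x ∈ Set.Ioc 0 η) :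
    ∫⁻ y in Set.Ioc 0 η, ENNReal.ofReal (1 / (3 * ((1 - η) * (1 - x * y / η)) ^ 3) -
      1 / (3 * ((1 - x) * (1 - y)) ^ 3)) =
    ENNReal.ofReal (η * (2 - x) / (6 * (1 - η) ^ 3 * (1 - x) ^ 2) -
      η * (2 - η) / (6 * (1 - x) ^ 3 * (1 - η) ^ 2)) := by
  have hx1 : 0 < 1 - x := by linarith [hx.2]
  have hη1 : 0 < 1 - η := by linarith
  have hu : ∀ y ∈ Set.Icc 0 η, 0 < 1 - x * y / η := by
    intro y hy
    have h2 : x * y / η < 1 := by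
      rw [div_lt_one h0]
      nlinarith [hx.1, hx.2, hy.1, hy.2]
    linarith
  have hy1 : ∀ y ∈ Set.Icc 0 η, 0 < 1 - y := fun y hy => by linarith [hy.2]
  -- The factor `η / x` compensates the inner derivative of `1 - x * y / η`; it is legitimate
  -- because `x > 0`.
  rw [lintegral_Ioc_of_hasDerivAt (F := fun y =>
    η / x / (6 * (1 - η) ^ 3) * (1 / (1 - x * y / η) ^ 2) -
      1 / (6 * (1 - x) ^ 3) * (1 / (1 - y) ^ 2)) h0.le]
  · congr 1
    have := hx.1.ne'
    simp only [mul_div_cancel_right₀ x h0.ne', mul_zero, zero_div, sub_zero]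
    field_simp
    ring
  · intro y hy
    have hu' := (hu y hy).ne'
    have hy' := (hy1 y hy).ne'
    have hx0 := hx.1.ne'
    have hd1 : HasDerivAt (fun y => (1 - x * y / η) ^ 2) (2 * (1 - x * y / η) * (-(x / η))) y := by
      have h := ((((hasDerivAt_id y).const_mul x).div_const η).const_sub 1).fun_pow 2
      simpa using h
    have hd2 : HasDerivAt (fun y => (1 - y) ^ 2) (2 * (1 - y) * -1) y := by
      simpa using ((hasDerivAt_id y).const_sub 1).fun_pow 2
    have hd := ((hd1.fun_inv (pow_ne_zero 2 hu')).const_mul (η / x / (6 * (1 - η) ^ 3))).fun_sub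
      ((hd2.fun_inv (pow_ne_zero 2 hy')).const_mul (1 / (6 * (1 - x) ^ 3)))
    simp only [one_div] at hd ⊢
    refine hd.congr_deriv ?_
    generalize 1 - x * y / η = u at hu'
    field_simp
    ring
  · refine ContinuousOn.sub (ContinuousOn.div continuousOn_const (by fun_prop) fun y hy => ?_)
      (ContinuousOn.div continuousOn_const (by fun_prop) fun y hy => ?_)
    · have := hu y hy; positivity
    · have := hy1 y hy; positivity
  · intro y hy
    have := hu y hy
    have := hy1 y hy
    rw [sub_nonneg]
    -- The gap decreases in `w`, so its value at the upper end of the range is at most its value at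
    -- `w = 0`.
    refine one_div_le_one_div_of_le (by positivity) ?_
    have h2 : 0 < (1 - η) * (1 - x * y / η) := by positivity
    refine mul_le_mul_of_nonneg_left (pow_le_pow_left₀ h2.le ?_ 3) (by norm_num)
    rw [← one_sub_mul_one_sub h0]
    have : 0 ≤ (η - x) * (η - y) / η :=
      div_nonneg (mul_nonneg (sub_nonneg.2 hx.2) (sub_nonneg.2 hy.2)) h0.le
    linarith

lemma lintegral_radial_fst (h0 : 0 < η) (h1 : η < 1) :
    ∫⁻ x in Set.Ioc 0 η, ENNReal.ofReal x *
      ENNReal.ofReal (η * (2 - x) / (6 * (1 - η) ^ 3 * (1 - x) ^ 2) -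
        η * (2 - η) / (6 * (1 - x) ^ 3 * (1 - η) ^ 2)) =
    ENNReal.ofReal (η ^ 4 / (12 * (1 - η) ^ 4)) := by
  have hη1 : 0 < 1 - η := by linarith
  have hx1 : ∀ x ∈ Set.Icc 0 η, 0 < 1 - x := fun x hx => by linarith [hx.2]
  have h2 : ∀ x ∈ Set.Ioc 0 η, ENNReal.ofReal x *
      ENNReal.ofReal (η * (2 - x) / (6 * (1 - η) ^ 3 * (1 - x) ^ 2) -
        η * (2 - η) / (6 * (1 - x) ^ 3 * (1 - η) ^ 2)) =
      ENNReal.ofReal (x * (η * (2 - x) / (6 * (1 - η) ^ 3 * (1 - x) ^ 2) -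
        η * (2 - η) / (6 * (1 - x) ^ 3 * (1 - η) ^ 2))) :=
    fun x hx => (ENNReal.ofReal_mul hx.1.le).symm
  -- Thanks to the weight `x`, both terms have rational primitives: `x (2 - x) / (1 - x)² = (1 -
  -- x)⁻² - 1`, and `2 x / (1 - x)³` is the derivative of `x² / (1 - x)²`.
  rw [setLIntegral_congr_fun measurableSet_Ioc h2, lintegral_Ioc_of_hasDerivAt (F := fun x =>
    η / (6 * (1 - η) ^ 3) * ((1 - x)⁻¹ - x) -
      η * (2 - η) / (12 * (1 - η) ^ 2) * (x ^ 2 * ((1 - x) ^ 2)⁻¹)) h0.le]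
  · congr 1
    field_simp
    ring
  · intro x hx
    have hx' := (hx1 x hx).ne'
    have hd1 : HasDerivAt (fun x : ℝ => 1 - x) (-1) x := (hasDerivAt_id x).const_sub 1
    have hd2 := (hd1.fun_inv hx').fun_sub (hasDerivAt_id' x)
    have hd3 := (hasDerivAt_pow 2 x).fun_mul ((hd1.fun_pow 2).fun_inv (pow_ne_zero 2 hx'))
    have hd := (hd2.const_mul (η / (6 * (1 - η) ^ 3))).fun_sub
      (hd3.const_mul (η * (2 - η) / (12 * (1 - η) ^ 2)))
    refine hd.congr_deriv ?_
    push_cast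
    field_simp
    ring
  · refine ContinuousOn.mul continuousOn_id (ContinuousOn.sub
      (ContinuousOn.div (by fun_prop) (by fun_prop) fun x hx => ?_)
      (ContinuousOn.div (by fun_prop) (by fun_prop) fun x hx => ?_))
    · have := hx1 x hx; positivity
    · have := hx1 x hx; positivity
  · intro x hx
    have h3 := hx1 x hx
    refine mul_nonneg hx.1 ?_
    have h4 : η * (2 - x) / (6 * (1 - η) ^ 3 * (1 - x) ^ 2) -
        η * (2 - η) / (6 * (1 - x) ^ 3 * (1 - η) ^ 2) =
        η * (η - x) * (3 - x - η) / (6 * (1 - η) ^ 3 * (1 - x) ^ 3) := by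
      field_simp
      ring
    rw [h4]
    have : 0 ≤ η - x := sub_nonneg.2 hx.2
    have : 0 ≤ 3 - x - η := by linarith
    positivity

lemma setLIntegral_cutDomain (h0 : 0 < η) (h1 : η < 1) :
    ∫⁻ Λ in cutDomain η, ENNReal.ofReal (1 / gap Λ ^ 4) =
      ENNReal.ofReal (Real.pi ^ 4 * (η ^ 4 / (12 * (1 - η) ^ 4))) := by
  set S : Set (ℝ × ℝ × ℝ) := {q | q.1 ≤ η ∧ q.2.1 ≤ η ∧
    0 ≤ η ^ 2 - η * (q.1 + q.2.1) + q.2.2} with hS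
  have hSm : MeasurableSet S := by
    have : S = {q | q.1 ≤ η} ∩ ({q | q.2.1 ≤ η} ∩
        {q | 0 ≤ η ^ 2 - η * (q.1 + q.2.1) + q.2.2}) := by
      ext q; exact Iff.rfl
    rw [this]
    refine IsClosed.measurableSet ((isClosed_le ?_ ?_).inter ((isClosed_le ?_ ?_).inter
      (isClosed_le ?_ ?_))) <;> fun_prop
  set G : ℝ × ℝ × ℝ → ℝ≥0∞ :=
    S.indicator fun q => ENNReal.ofReal (1 / (1 - q.1 - q.2.1 + q.2.2) ^ 4) with hG
  have hGm : Measurable G := Measurable.indicator (by fun_prop) hSm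
  have h2 : ∀ Λ : Fin 2 → Fin 2 → ℂ,
      (cutDomain η).indicator (fun Λ => ENNReal.ofReal (1 / gap Λ ^ 4)) Λ =
      G (normSq (Λ 0 0) + normSq (Λ 0 1),
      normSq (Λ 1 0) + normSq (Λ 1 1), normSq (Λ 0 0 * Λ 1 1 - Λ 0 1 * Λ 1 0)) := by
    intro Λ
    simp only [hG, Set.indicator, hS, Set.mem_ofPred_eq, mem_cutDomain_iff, gap_eq]
  rw [← lintegral_indicator (measurableSet_cutDomain η), lintegral_congr h2, lintegral_matrix hGm]
  have h3 : ∀ x ∈ Set.Ioi (0 : ℝ), ∀ y ∈ Set.Ioi (0 : ℝ), ∀ w ∈ Set.Ioi (0 : ℝ),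
      (G (x, w + y, x * y) = if x ≤ η ∧ y ≤ η then
        (Set.Iic ((η - x) * (η - y) / η)).indicator (fun w =>
          ENNReal.ofReal (1 / ((1 - x) * (1 - y) - w) ^ 4)) w else 0) := by
    intro x hx y hy w hw
    simp only [Set.mem_Ioi] at hx hy hw
    have h4 : (x, w + y, x * y) ∈ S ↔ (x ≤ η ∧ y ≤ η) ∧ w ≤ (η - x) * (η - y) / η := by
      simp only [hS, Set.mem_ofPred_eq, le_div_iff₀ h0]
      constructor
      · rintro ⟨h5, h6, h7⟩
        exact ⟨⟨h5, by linarith⟩, by nlinarith⟩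
      · rintro ⟨⟨h5, h6⟩, h7⟩
        refine ⟨h5, ?_, by nlinarith⟩
        -- The row bound `w + y ≤ η` is redundant: the bound on `w` already gives `w ≤ η - y`.
        have h8 : (η - x) * (η - y) ≤ η * (η - y) :=
          mul_le_mul_of_nonneg_right (by linarith) (by linarith)
        nlinarith
    by_cases h5 : x ≤ η ∧ y ≤ η
    · rw [if_pos h5]
      simp only [hG, Set.indicator, h4, h5, true_and, Set.mem_Iic, and_self]
      congr 4
      ring
    · rw [if_neg h5, hG, Set.indicator_of_notMem]
      exact fun h => h5 (h4.1 h).1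
  have h4 : ∀ x ∈ Set.Ioi (0 : ℝ), ENNReal.ofReal x *
      ∫⁻ y in Set.Ioi 0, ∫⁻ w in Set.Ioi 0, G (x, w + y, x * y) =
      (Set.Iic η).indicator (fun x => ENNReal.ofReal x *
      ENNReal.ofReal (η * (2 - x) / (6 * (1 - η) ^ 3 * (1 - x) ^ 2) -
        η * (2 - η) / (6 * (1 - x) ^ 3 * (1 - η) ^ 2))) x := by
    intro x hx
    have h5 : ∀ y ∈ Set.Ioi (0 : ℝ), ∫⁻ w in Set.Ioi 0, G (x, w + y, x * y) =
        if x ≤ η then (Set.Iic η).indicator (fun y =>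
          ENNReal.ofReal (1 / (3 * ((1 - η) * (1 - x * y / η)) ^ 3) -
            1 / (3 * ((1 - x) * (1 - y)) ^ 3))) y else 0 := by
      intro y hy
      rw [setLIntegral_congr_fun measurableSet_Ioi (h3 x hx y hy)]
      by_cases hxη : x ≤ η
      · by_cases hyη : y ≤ η
        · simp only [hxη, hyη, and_self, if_true]
          rw [setLIntegral_indicator measurableSet_Iic, Set.inter_comm, Set.Ioi_inter_Iic,
            lintegral_radial_perp h0 h1 ⟨hx, hxη⟩ ⟨hy, hyη⟩]
          simp [Set.indicator, hyη]
        · simp [Set.indicator, hyη]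
      · simp [hxη]
    rw [setLIntegral_congr_fun measurableSet_Ioi h5]
    by_cases hxη : x ≤ η
    · simp only [hxη, if_true]
      rw [setLIntegral_indicator measurableSet_Iic, Set.inter_comm, Set.Ioi_inter_Iic,
        lintegral_radial_snd h0 h1 ⟨hx, hxη⟩]
      simp [Set.indicator, hxη]
    · simp [Set.indicator, hxη]
  rw [setLIntegral_congr_fun measurableSet_Ioi h4, setLIntegral_indicator measurableSet_Iic,
    Set.inter_comm, Set.Ioi_inter_Iic, lintegral_radial_fst h0 h1,
    ← ENNReal.ofReal_pow Real.pi_pos.le, ← ENNReal.ofReal_mul (by positivity)]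

end Radial

lemma invMeasure_cutDomain {n : ℕ} (hn : 3 ≤ n) {η : ℝ} (h0 : 0 ≤ η) (h1 : η < 1) :
    invMeasure n (cutDomain η) = ENNReal.ofReal
      (((n : ℝ) - 1) * ((n : ℝ) - 2) ^ 2 * ((n : ℝ) - 3) * η ^ 4 / (12 * (1 - η) ^ 4)) := by
  have hn' : (3 : ℝ) ≤ n := by exact_mod_cast hn
  set c := ((n : ℝ) - 1) * ((n : ℝ) - 2) ^ 2 * ((n : ℝ) - 3) with hc
  have hc0 : 0 ≤ c :=
    mul_nonneg (mul_nonneg (by linarith) (sq_nonneg _)) (by linarith)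
  have hgm := continuous_gap.measurable
  rw [invMeasure, withDensity_apply _ (measurableSet_cutDomain η),
    Measure.restrict_restrict (measurableSet_cutDomain η),
    Set.inter_eq_left.2 (cutDomain_subset_domain h1)]
  -- The radial computation divides by `η`. For `η = 0`, the case `K = n - 5` of the theorem, the
  -- cut domain is a null set.
  rcases h0.eq_or_lt with rfl | h0
  · have hz : cutDomain 0 ⊆ {0} := by
      intro Λ hΛ
      obtain ⟨ha, hb, -⟩ := mem_cutDomain_iff.1 hΛ
      have h2 : ∀ i j, Λ i j = 0 := by
        simp only [← normSq_eq_zero, Fin.forall_fin_two]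
        have := normSq_nonneg (Λ 0 0)
        have := normSq_nonneg (Λ 0 1)
        have := normSq_nonneg (Λ 1 0)
        have := normSq_nonneg (Λ 1 1)
        refine ⟨⟨?_, ?_⟩, ?_, ?_⟩ <;> linarith
      exact Set.mem_singleton_iff.2 (funext fun i => funext fun j => h2 i j)
    have : (volume : Measure (Fin 2 → Fin 2 → ℂ)).IsAddHaarMeasure :=
      Measure.pi.isAddHaarMeasure fun _ => volume
    have hv : (volume : Measure (Fin 2 → Fin 2 → ℂ)) {0} = 0 := measure_singleton _
    rw [setLIntegral_measure_zero _ _ (measure_mono_null hz hv)]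
    simp
  · have h2 : ∀ Λ ∈ cutDomain η, ENNReal.ofReal (c / (Real.pi ^ 4 * gap Λ ^ 4)) =
        ENNReal.ofReal (c / Real.pi ^ 4) * ENNReal.ofReal (1 / gap Λ ^ 4) := by
      intro Λ _
      rw [← ENNReal.ofReal_mul (by positivity)]
      congr 1
      rw [div_mul_div_comm, mul_one]
    rw [setLIntegral_congr_fun (measurableSet_cutDomain η) h2,
      lintegral_const_mul _ (by fun_prop), setLIntegral_cutDomain h0 h1,
      ← ENNReal.ofReal_mul (by positivity)]
    congr 1
    have : 0 < 1 - η := by linarith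
    field_simp

/-! ### Gaussian integrals -/

lemma integrable_gauss {a : ℝ} (ha : 0 < a) (c : ℂ) :
    Integrable fun z : ℂ => Real.exp (2 * (c * z).re - a * normSq z) := by
  have h := (GaussianFourier.integrable_cexp_neg_mul_sq_norm_add (b := (a : ℂ)) (V := ℂ)
    (by simpa using ha) 2 (conj c)).norm
  refine h.congr (Eventually.of_forall fun z => ?_)
  simp only [Complex.norm_exp]
  congr 1
  simp [← ofReal_pow, normSq_eq_norm_sq, Complex.inner]
  ring

/-- `Re (c z)` is the real inner product of `conj c` with `z`, so this is the Gaussian integral with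
a linear term in real dimension two. -/
lemma integral_gauss {a : ℝ} (ha : 0 < a) (c : ℂ) :
    ∫ z : ℂ, Real.exp (2 * (c * z).re - a * normSq z) =
      Real.pi / a * Real.exp (normSq c / a) := by
  have h := GaussianFourier.integral_cexp_neg_mul_sq_norm_add (b := (a : ℂ)) (V := ℂ)
    (by simpa using ha) 2 (conj c)
  rw [← ofReal_inj, ← integral_complex_ofReal]
  have h2 : ∀ z : ℂ, ((Real.exp (2 * (c * z).re - a * normSq z) : ℝ) : ℂ) =
      cexp (-(a : ℂ) * (‖z‖ : ℂ) ^ 2 + 2 * (inner ℝ (conj c) z : ℝ)) := by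
    intro z
    rw [ofReal_exp]
    congr 1
    simp [normSq_eq_norm_sq, Complex.inner]
    ring
  simp only [h2]
  rw [h]
  have : (a : ℂ) ≠ 0 := by exact_mod_cast ha.ne'
  have h3 : (2 : ℂ) ^ 2 * (‖conj c‖ : ℂ) ^ 2 / (4 * a) = ((normSq c / a : ℝ) : ℂ) := by
    rw [RCLike.norm_conj, normSq_eq_norm_sq]
    push_cast
    field_simp
    ring
  rw [h3]
  simp

lemma lintegral_gauss {a : ℝ} (ha : 0 < a) (c : ℂ) :
    ∫⁻ z : ℂ, ENNReal.ofReal (Real.exp (2 * (c * z).re - a * normSq z)) =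
      ENNReal.ofReal (Real.pi / a * Real.exp (normSq c / a)) := by
  rw [← integral_gauss ha c, ofReal_integral_eq_lintegral_ofReal (integrable_gauss ha c)
    (Eventually.of_forall fun z => (Real.exp_pos _).le)]

/-- The Gaussian integral of a positive Hermitian form in two variables. -/
lemma lintegral_gauss_form {p r : ℝ} {q : ℂ} (hp : 0 < p) (h : 0 < p * r - normSq q) :
    ∫⁻ v : ℂ × ℂ, ENNReal.ofReal (Real.exp (-(p * normSq v.1 + r * normSq v.2 -
      2 * (q * v.1 * conj v.2).re))) = ENNReal.ofReal (Real.pi ^ 2 / (p * r - normSq q)) := by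
  have hc := continuous_normSq
  have hm : Measurable fun v : ℂ × ℂ => ENNReal.ofReal (Real.exp (-(p * normSq v.1 +
      r * normSq v.2 - 2 * (q * v.1 * conj v.2).re))) :=
    (Continuous.measurable (by fun_prop)).ennreal_ofReal
  -- This Schur complement is the coefficient left on the second variable once the first is
  -- integrated out.
  have hk : 0 < r - normSq q / p := by
    rw [sub_pos, div_lt_iff₀ hp]; linarith
  rw [Measure.volume_eq_prod, lintegral_prod_symm _ hm.aemeasurable]
  have h1 : ∀ y : ℂ, ∫⁻ x : ℂ, ENNReal.ofReal (Real.exp (-(p * normSq x +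
      r * normSq y - 2 * (q * x * conj y).re))) =
      ENNReal.ofReal (Real.pi / p) * ENNReal.ofReal (Real.exp (2 * (0 * y).re -
        (r - normSq q / p) * normSq y)) := by
    intro y
    have h2 : ∀ x : ℂ, ENNReal.ofReal (Real.exp (-(p * normSq x +
        r * normSq y - 2 * (q * x * conj y).re))) = ENNReal.ofReal (Real.exp (-(r * normSq y))) *
        ENNReal.ofReal (Real.exp (2 * ((q * conj y) * x).re - p * normSq x)) := by
      intro x
      rw [← ENNReal.ofReal_mul (Real.exp_pos _).le, ← Real.exp_add, mul_right_comm q x]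
      congr 2
      ring
    rw [lintegral_congr h2, lintegral_const_mul _
      (Continuous.measurable (by fun_prop)).ennreal_ofReal, lintegral_gauss hp,
      ← ENNReal.ofReal_mul (Real.exp_pos _).le, ← ENNReal.ofReal_mul (by positivity),
      mul_left_comm, ← Real.exp_add]
    congr 3
    simp
    ring
  simp only [h1]
  rw [lintegral_const_mul _ (Continuous.measurable (by fun_prop)).ennreal_ofReal,
    lintegral_gauss hk, ← ENNReal.ofReal_mul (by positivity)]
  congr 1
  have : r * p - normSq q ≠ 0 := by rw [mul_comm]; exact h.ne'
  simp
  field_simp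

/-- The form `|x|² - |Λᵀ x|²` has as matrix the complex conjugate of `1 - Λ Λ†`, hence the same
determinant. -/
lemma normSq_transpose_apply (Λ : Fin 2 → Fin 2 → ℂ) (x : Fin 2 → ℂ) :
    normSq (x 0) + normSq (x 1) - ∑ j, normSq (∑ i, Λ i j * x i) =
      (1 - (normSq (Λ 0 0) + normSq (Λ 0 1))) * normSq (x 0) +
      (1 - (normSq (Λ 1 0) + normSq (Λ 1 1))) * normSq (x 1) -
      2 * ((Λ 0 0 * conj (Λ 1 0) + Λ 0 1 * conj (Λ 1 1)) * x 0 * conj (x 1)).re := by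
  simp [Fin.sum_univ_two, normSq_apply]
  ring

lemma integral_gauss_gap {Λ : Fin 2 → Fin 2 → ℂ} (hΛ : Λ ∈ domain) :
    ∫ x : Fin 2 → ℂ, Real.exp (-(normSq (x 0) + normSq (x 1) - ∑ j, normSq (∑ i, Λ i j * x i))) =
      Real.pi ^ 2 / gap Λ := by
  have hc := continuous_normSq
  have hgap := gap_pos hΛ
  have hp : 0 < 1 - (normSq (Λ 0 0) + normSq (Λ 0 1)) := by
    have h := (Complex.pos_iff.1 (Matrix.PosDef.diag_pos hΛ (i := 0))).1
    simp [Matrix.mul_apply, Fin.sum_univ_two] at h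
    simp only [normSq_apply]; linarith
  have hdet : (1 - (normSq (Λ 0 0) + normSq (Λ 0 1))) * (1 - (normSq (Λ 1 0) + normSq (Λ 1 1))) -
      normSq (Λ 0 0 * conj (Λ 1 0) + Λ 0 1 * conj (Λ 1 1)) = gap Λ := by
    have := normSq_rows (Λ 0 0) (Λ 0 1) (Λ 1 0) (Λ 1 1)
    rw [gap_eq]; linarith
  rw [integral_eq_lintegral_of_nonneg_ae (Eventually.of_forall fun x => (Real.exp_pos _).le)
    (Continuous.aestronglyMeasurable (by fun_prop))]
  have h1 := lintegral_gauss_form hp (hdet ▸ hgap)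
  rw [← (volume_preserving_finTwoArrow ℂ).lintegral_comp
    (Continuous.measurable (by fun_prop)).ennreal_ofReal, hdet] at h1
  simp only [normSq_transpose_apply]
  have h2 := congrArg ENNReal.toReal h1
  rw [ENNReal.toReal_ofReal (by positivity)] at h2
  exact h2

lemma norm_sq_cohFun (n : ℕ) (Λ : Fin 2 → Fin 2 → ℂ) (p : Modes n) :
    ‖cohFun n Λ p‖ ^ 2 = (gap Λ ^ ((n : ℝ) / 2)) ^ 2 *
      Real.exp (2 * (∑ i, ∑ j, Λ i j * Z p i j).re) := by
  rw [cohFun, norm_mul, mul_pow, Complex.norm_real, Real.norm_eq_abs, sq_abs, Complex.norm_exp,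
    ← Real.exp_nat_mul]
  norm_num

lemma integrable_kernel (n : ℕ) {Λ : Fin 2 → Fin 2 → ℂ} (hΛ : Λ ∈ domain) :
    Integrable fun p : Modes n =>
      Real.exp (2 * (∑ i, ∑ j, Λ i j * Z p i j).re - sqNorm p) := by
  have hc := (differentiable_cohFun n Λ).continuous
  have hsq := continuous_sqNorm n
  have hgap := gap_pos hΛ
  have h := memLp_cohFun n hΛ
  rw [memLp_two_iff_integrable_sq_norm hc.aestronglyMeasurable, gaussian,
    integrable_withDensity_iff (by fun_prop) (by simp)] at h
  refine (h.const_mul (((gap Λ ^ ((n : ℝ) / 2)) ^ 2)⁻¹ * Real.pi ^ (4 * n))).congr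
    (Eventually.of_forall fun p => ?_)
  have := Real.rpow_pos_of_pos hgap ((n : ℝ) / 2)
  simp only [norm_sq_cohFun]
  rw [ENNReal.toReal_ofReal (density_pos _).le, sub_eq_add_neg, Real.exp_add]
  field_simp

/-- The exponent is a sum over `k`, so the integral is an `n`-th power. For each `k`, integrating
`z'` yields `π²` and the exponential of `|Λᵀ z|²`, and integrating `z` yields `π² / gap Λ`. -/
lemma integral_kernel (n : ℕ) {Λ : Fin 2 → Fin 2 → ℂ} (hΛ : Λ ∈ domain) :
    ∫ p : Modes n, Real.exp (2 * (∑ i, ∑ j, Λ i j * Z p i j).re - sqNorm p) =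
      (Real.pi ^ 4 / gap Λ) ^ n := by
  rw [Measure.volume_eq_prod, integral_prod _ (by
    rw [← Measure.volume_eq_prod]; exact integrable_kernel n hΛ)]
  have h1 : ∀ z : Fin n → Fin 2 → ℂ, ∫ z' : Fin n → Fin 2 → ℂ,
      Real.exp (2 * (∑ i, ∑ j, Λ i j * Z (z, z') i j).re - sqNorm (z, z')) =
      ∏ k, (Real.pi ^ 2 * Real.exp (-(normSq (z k 0) + normSq (z k 1) -
        ∑ j, normSq (∑ i, Λ i j * z k i)))) := by
    intro z
    have h2 : ∀ z' : Fin n → Fin 2 → ℂ,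
        Real.exp (2 * (∑ i, ∑ j, Λ i j * Z (z, z') i j).re - sqNorm (z, z')) =
        (∏ k, Real.exp (-(normSq (z k 0) + normSq (z k 1)))) *
        ∏ k, ∏ j, Real.exp (2 * ((∑ i, Λ i j * z k i) * z' k j).re - 1 * normSq (z' k j)) := by
      intro z'
      simp only [← Real.exp_sum]
      rw [← Real.exp_add]
      congr 1
      have h3 : ∑ i, ∑ j, Λ i j * Z (z, z') i j =
          ∑ k, ∑ j, (∑ i, Λ i j * z k i) * z' k j := by
        simp only [Z, Fin.sum_univ_two, Finset.mul_sum, ← Finset.sum_add_distrib]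
        refine Finset.sum_congr rfl fun k _ => ?_
        ring
      rw [h3, sqNorm, Complex.re_sum, Finset.mul_sum, ← Finset.sum_add_distrib,
        ← Finset.sum_add_distrib, ← Finset.sum_sub_distrib]
      refine Finset.sum_congr rfl fun k _ => ?_
      simp only [Fin.sum_univ_two, ← normSq_eq_norm_sq, add_re]
      ring
    simp only [h2]
    rw [integral_const_mul]
    rw [integral_fintype_prod_volume_eq_prod (f := fun (k : Fin n) (y : Fin 2 → ℂ) =>
      ∏ j, Real.exp (2 * ((∑ i, Λ i j * z k i) * y j).re - 1 * normSq (y j))),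
      ← Finset.prod_mul_distrib]
    refine Finset.prod_congr rfl fun k _ => ?_
    rw [integral_fintype_prod_volume_eq_prod (f := fun (j : Fin 2) (y : ℂ) =>
      Real.exp (2 * ((∑ i, Λ i j * z k i) * y).re - 1 * normSq y))]
    simp only [integral_gauss one_pos, div_one, Fin.prod_univ_two]
    rw [Fin.sum_univ_two (fun j => normSq (∑ i, Λ i j * z k i)), neg_sub, sub_eq_add_neg,
      Real.exp_add, Real.exp_add]
    ring
  simp only [h1]
  rw [integral_fintype_prod_volume_eq_pow (fun x : Fin 2 → ℂ => Real.pi ^ 2 *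
    Real.exp (-(normSq (x 0) + normSq (x 1) - ∑ j, normSq (∑ i, Λ i j * x i)))),
    integral_const_mul, integral_gauss_gap hΛ, Fintype.card_fin]
  congr 1
  ring

lemma integral_gaussian (n : ℕ) (f : Modes n → ℝ) :
    ∫ p, f p ∂(gaussian n) = ∫ p, ((Real.pi ^ (4 * n))⁻¹ * Real.exp (-sqNorm p)) * f p := by
  have hsq := continuous_sqNorm n
  rw [gaussian, integral_withDensity_eq_integral_toReal_smul
    (Continuous.measurable (by fun_prop)).ennreal_ofReal (by simp)]
  simp only [ENNReal.toReal_ofReal (density_pos _).le, smul_eq_mul]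

lemma integral_norm_sq_cohFun (n : ℕ) {Λ : Fin 2 → Fin 2 → ℂ} (hΛ : Λ ∈ domain) :
    ∫ p, ‖cohFun n Λ p‖ ^ 2 ∂(gaussian n) = 1 := by
  have hgap := gap_pos hΛ
  have h1 : ∀ p : Modes n, ((Real.pi ^ (4 * n))⁻¹ * Real.exp (-sqNorm p)) * ‖cohFun n Λ p‖ ^ 2 =
      ((Real.pi ^ (4 * n))⁻¹ * gap Λ ^ n) *
        Real.exp (2 * (∑ i, ∑ j, Λ i j * Z p i j).re - sqNorm p) := by
    intro p
    have h2 : (gap Λ ^ ((n : ℝ) / 2)) ^ 2 = gap Λ ^ n := by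
      rw [← Real.rpow_mul_natCast hgap.le, ← Real.rpow_natCast]
      congr 1
      push_cast
      ring
    rw [norm_sq_cohFun, h2, sub_eq_add_neg, Real.exp_add]
    ring
  rw [integral_gaussian]
  simp only [h1]
  rw [integral_const_mul, integral_kernel n hΛ, div_pow, ← pow_mul]
  field_simp

/-! ### The coherent states -/

/-- The inclusion of the Fock space into `L²` of the Gaussian measure. -/
def toL2 (n : ℕ) : Fock n →ₗᵢ[ℂ] Lp ℂ 2 (gaussian n) := (fockSubmodule n).subtypeₗᵢ

lemma norm_sq_fock_eq {n : ℕ} (f : Fock n) {g : Modes n → ℂ} (h : toL2 n f =ᵐ[gaussian n] g) :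
    ‖f‖ ^ 2 = ∫ p, ‖g p‖ ^ 2 ∂(gaussian n) := by
  rw [← (toL2 n).norm_map, ← ofReal_inj, ofReal_pow]
  have h2 := @inner_self_eq_norm_sq_to_K ℂ _ _ _ _ (toL2 n f)
  rw [L2.inner_def] at h2
  refine Eq.trans h2.symm ?_
  rw [← integral_complex_ofReal]
  refine integral_congr_ae ?_
  filter_upwards [h] with p hp
  rw [hp, inner_self_eq_norm_sq_to_K]
  simp

lemma coherent_ae_eq (n : ℕ) {Λ : Fin 2 → Fin 2 → ℂ} (hΛ : Λ ∈ domain) :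
    toL2 n (coherent n Λ) =ᵐ[gaussian n] cohFun n Λ := by
  have h : toL2 n (coherent n Λ) = (memLp_cohFun n hΛ).toLp :=
    congrArg (toL2 n) (dif_pos hΛ)
  rw [h]
  exact (memLp_cohFun n hΛ).coeFn_toLp

lemma norm_coherent (n : ℕ) {Λ : Fin 2 → Fin 2 → ℂ} (hΛ : Λ ∈ domain) : ‖coherent n Λ‖ = 1 := by
  have h := norm_sq_fock_eq (coherent n Λ) (coherent_ae_eq n hΛ)
  rw [integral_norm_sq_cohFun n hΛ] at h
  exact (pow_eq_one_iff_of_nonneg (norm_nonneg _) two_ne_zero).1 h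

/-! ### Continuity of the coherent states -/

lemma re_pairing_le (Λ : Fin 2 → Fin 2 → ℂ) (x y : Fin 2 → ℂ) :
    2 * (∑ i, ∑ j, Λ i j * (x i * y j)).re ≤
      2 * ‖Λ‖ * ((∑ i, ‖x i‖ ^ 2) + ∑ j, ‖y j‖ ^ 2) := by
  have h1 : ∀ i j, 2 * (Λ i j * (x i * y j)).re ≤ ‖Λ‖ * (‖x i‖ ^ 2 + ‖y j‖ ^ 2) := by
    intro i j
    have h2 : ‖Λ i j‖ ≤ ‖Λ‖ := (norm_le_pi_norm (Λ i) j).trans (norm_le_pi_norm Λ i)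
    have h3 := Complex.re_le_norm (Λ i j * (x i * y j))
    rw [norm_mul, norm_mul] at h3
    have h4 : 2 * (‖x i‖ * ‖y j‖) ≤ ‖x i‖ ^ 2 + ‖y j‖ ^ 2 := by
      nlinarith [sq_nonneg (‖x i‖ - ‖y j‖)]
    calc 2 * (Λ i j * (x i * y j)).re ≤ ‖Λ i j‖ * (2 * (‖x i‖ * ‖y j‖)) := by linarith
      _ ≤ ‖Λ‖ * (‖x i‖ ^ 2 + ‖y j‖ ^ 2) := by gcongr
  have h00 := h1 0 0
  have h01 := h1 0 1
  have h10 := h1 1 0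
  have h11 := h1 1 1
  simp only [Fin.sum_univ_two, add_re]
  linarith

lemma eventually_re_le (n : ℕ) {Λ₀ : Fin 2 → Fin 2 → ℂ} (hΛ₀ : Λ₀ ∈ domain) :
    ∃ s < 1, ∀ᶠ Λ in 𝓝 Λ₀, ∀ p : Modes n,
      2 * (∑ i, ∑ j, Λ i j * Z p i j).re ≤ s * sqNorm p := by
  obtain ⟨s, hs, hb⟩ := uniform_bound hΛ₀
  -- A perturbation of norm at most `(1 - s) / 4` costs `(1 - s) / 2` by `re_pairing_le`, and `s +
  -- (1 - s) / 2 = (1 + s) / 2`.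
  refine ⟨(1 + s) / 2, by linarith, ?_⟩
  filter_upwards [Metric.closedBall_mem_nhds Λ₀ (ε := (1 - s) / 4) (by linarith)] with Λ hΛ p
  have hΛ' : ‖Λ - Λ₀‖ ≤ (1 - s) / 4 := by simpa [dist_eq_norm] using hΛ
  have h3 : ∑ i, ∑ j, Λ i j * Z p i j = ∑ k, ∑ i, ∑ j, Λ i j * (p.1 k i * p.2 k j) := by
    simp only [Z, Fin.sum_univ_two, Finset.mul_sum, Finset.sum_add_distrib]
  rw [h3, Complex.re_sum, Finset.mul_sum, sqNorm, ← Finset.sum_add_distrib, Finset.mul_sum]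
  refine Finset.sum_le_sum fun k _ => ?_
  have h4 := hb (p.1 k) (p.2 k)
  have h5 := re_pairing_le (Λ - Λ₀) (p.1 k) (p.2 k)
  have h6 : ∑ i, ∑ j, (Λ - Λ₀) i j * (p.1 k i * p.2 k j) =
      ∑ i, ∑ j, Λ i j * (p.1 k i * p.2 k j) - ∑ i, ∑ j, Λ₀ i j * (p.1 k i * p.2 k j) := by
    simp only [Fin.sum_univ_two, Pi.sub_apply]
    ring
  rw [h6, sub_re] at h5
  have h7 : 0 ≤ (∑ i, ‖p.1 k i‖ ^ 2) + ∑ j, ‖p.2 k j‖ ^ 2 := by positivity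
  nlinarith

lemma continuous_cohFun (n : ℕ) (p : Modes n) : Continuous fun Λ => cohFun n Λ p := by
  have h := continuous_gap.rpow_const (p := (n : ℝ) / 2) fun _ => Or.inr (by positivity)
  unfold cohFun
  fun_prop

/-- Dominated convergence for the squared `L²` distance; `eventually_re_le` gives a Gaussian
majorant uniform near `Λ₀`. Continuity supplies the strong measurability needed for the Bochner
integral. -/
lemma continuousOn_coherent (n : ℕ) : ContinuousOn (coherent n) domain := by
  intro Λ₀ hΛ₀
  have hsq := continuous_sqNorm n
  have hrpow : Continuous fun Λ => gap Λ ^ ((n : ℝ) / 2) :=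
    continuous_gap.rpow_const fun _ => Or.inr (by positivity)
  obtain ⟨s, hs, hb⟩ := eventually_re_le n hΛ₀
  set C : ℝ := (gap Λ₀ ^ ((n : ℝ) / 2)) ^ 2 + 1
  have hC : ∀ᶠ Λ in 𝓝 Λ₀, (gap Λ ^ ((n : ℝ) / 2)) ^ 2 ≤ C :=
    ((hrpow.pow 2).continuousAt.eventually_lt continuousAt_const (lt_add_one _)).mono
      fun _ h => h.le
  have hbound : ∀ᶠ Λ in 𝓝 Λ₀, ∀ p : Modes n,
      ‖cohFun n Λ p‖ ^ 2 ≤ C * Real.exp (s * sqNorm p) := by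
    filter_upwards [hb, hC] with Λ h1 h2 p
    rw [norm_sq_cohFun]
    have := h1 p
    gcongr
  have hbound₀ := hbound.self_of_nhds
  have hlim : Tendsto (fun Λ => ∫ p, ((Real.pi ^ (4 * n))⁻¹ * Real.exp (-sqNorm p)) *
      ‖cohFun n Λ p - cohFun n Λ₀ p‖ ^ 2) (𝓝[domain] Λ₀) (𝓝 (∫ _ : Modes n, 0)) := by
    refine tendsto_integral_filter_of_dominated_convergence
      (fun p => (Real.pi ^ (4 * n))⁻¹ * (4 * C) * Real.exp (-(1 - s) * sqNorm p)) ?_ ?_ ?_ ?_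
    · refine Eventually.of_forall fun Λ => Continuous.aestronglyMeasurable ?_
      have h1 := (differentiable_cohFun n Λ).continuous
      have h2 := (differentiable_cohFun n Λ₀).continuous
      fun_prop
    · filter_upwards [nhdsWithin_le_nhds hbound] with Λ hΛ
      refine Eventually.of_forall fun p => ?_
      rw [Real.norm_of_nonneg (by positivity)]
      have h1 : ‖cohFun n Λ p - cohFun n Λ₀ p‖ ^ 2 ≤ 4 * C * Real.exp (s * sqNorm p) := by
        have h2 := norm_sub_le (cohFun n Λ p) (cohFun n Λ₀ p)
        have h3 : ‖cohFun n Λ p - cohFun n Λ₀ p‖ ^ 2 ≤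
            (‖cohFun n Λ p‖ + ‖cohFun n Λ₀ p‖) ^ 2 := pow_le_pow_left₀ (norm_nonneg _) h2 2
        have h4 := hΛ p
        have h5 := hbound₀ p
        nlinarith [sq_nonneg (‖cohFun n Λ p‖ - ‖cohFun n Λ₀ p‖)]
      calc _ ≤ (Real.pi ^ (4 * n))⁻¹ * Real.exp (-sqNorm p) *
            (4 * C * Real.exp (s * sqNorm p)) := by gcongr
        _ = (Real.pi ^ (4 * n))⁻¹ * (4 * C) *
            (Real.exp (-sqNorm p) * Real.exp (s * sqNorm p)) := by ring
        _ = _ := by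
          rw [← Real.exp_add]
          congr 2
          ring
    · exact (integrable_exp_neg_sqNorm n (sub_pos.2 hs)).const_mul _
    · refine Eventually.of_forall fun p => ?_
      have h1 : Continuous fun Λ => ((Real.pi ^ (4 * n))⁻¹ * Real.exp (-sqNorm p)) *
          ‖cohFun n Λ p - cohFun n Λ₀ p‖ ^ 2 := by
        have := continuous_cohFun n p
        fun_prop
      have h2 := h1.tendsto Λ₀
      simp only [sub_self, norm_zero] at h2
      refine (h2.mono_left nhdsWithin_le_nhds).trans_eq ?_
      simp
  rw [integral_zero] at hlim
  have hsqlim : Tendsto (fun Λ => ‖coherent n Λ - coherent n Λ₀‖ ^ 2) (𝓝[domain] Λ₀) (𝓝 0) := by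
    refine hlim.congr' ?_
    filter_upwards [self_mem_nhdsWithin] with Λ hΛ
    rw [← integral_gaussian]
    symm
    refine norm_sq_fock_eq (g := fun p => cohFun n Λ p - cohFun n Λ₀ p) _ ?_
    rw [map_sub]
    exact (Lp.coeFn_sub _ _).trans ((coherent_ae_eq n hΛ).sub (coherent_ae_eq n hΛ₀))
  refine tendsto_iff_norm_sub_tendsto_zero.2 ?_
  have h := hsqlim.sqrt
  simpa [Real.sqrt_sq (norm_nonneg _)] using h

/-- Separability is inherited from `L²`; it makes orthonormal bases countable, so that sums over
them commute with integrals. -/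
instance secondCountableTopology_fock (n : ℕ) : SecondCountableTopology (Fock n) := by
  have : Fact ((2 : ℝ≥0∞) ≠ ∞) := ⟨by simp⟩
  have : SFinite (gaussian n) := inferInstance
  have : MeasurableSpace.CountablyGenerated (Modes n) := inferInstance
  have : MeasureTheory.IsSeparable (gaussian n) := inferInstance
  exact (toL2 n).isometry.isEmbedding.secondCountableTopology

/-! ### The trace of an integral of projectors -/

section Trace

variable {H : Type*} [NormedAddCommGroup H] [InnerProductSpace ℂ H]

/-- Distinct orthonormal vectors are `√2` apart, so the balls of radius `1 / 2` around them are
disjoint open sets. -/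
lemma countable_of_orthonormal [SecondCountableTopology H] {ι : Type*} {v : ι → H}
    (hv : Orthonormal ℂ v) : Countable ι := by
  have hd : ∀ i j, i ≠ j → 1 ≤ dist (v i) (v j) := by
    intro i j hij
    have h1 : ‖v i - v j‖ ^ 2 = 2 := by
      rw [@norm_sub_sq ℂ, hv.1 i, hv.1 j, hv.2 hij]
      norm_num
    rw [dist_eq_norm]
    nlinarith [norm_nonneg (v i - v j)]
  have hdisj : Pairwise (Function.onFun Disjoint fun i => Metric.ball (v i) (1 / 2)) := by
    intro i j hij
    exact Metric.ball_disjoint_ball (by norm_num; exact hd i j hij)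
  exact Set.countable_univ_iff.1 (Set.PairwiseDisjoint.countable_of_isOpen (s := fun i =>
    Metric.ball (v i) (1 / 2)) (fun i _ j _ h => hdisj h) (fun i _ => Metric.isOpen_ball)
    (fun i _ => Metric.nonempty_ball.2 (by norm_num)))

variable {α : Type*} {mα : MeasurableSpace α} {μ : Measure α} [IsFiniteMeasure μ] {ψ : α → H}

lemma integrable_rankOne (hψ : AEStronglyMeasurable ψ μ) (h1 : ∀ᵐ a ∂μ, ‖ψ a‖ = 1) :
    Integrable (fun a => InnerProductSpace.rankOne ℂ (ψ a) (ψ a)) μ := by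
  refine Integrable.of_bound (C := 1) ?_ ?_
  · have hc : Continuous fun x : H => InnerProductSpace.rankOne ℂ x x := by
      simp only [InnerProductSpace.rankOne_def']
      exact (ContinuousLinearMap.toSpanSingletonCLE (𝕜 := ℂ) (E := H)).continuous.clm_comp
        (innerSL ℂ).continuous
    exact hc.comp_aestronglyMeasurable hψ
  · filter_upwards [h1] with a ha
    simp [ha]

/-- Diagonal matrix elements pass through the Bochner integral; this yields both positivity and the
trace. -/
lemma inner_integral_rankOne [CompleteSpace H] (hψ : AEStronglyMeasurable ψ μ)
    (h1 : ∀ᵐ a ∂μ, ‖ψ a‖ = 1) (x : H) :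
    inner ℂ x ((∫ a, InnerProductSpace.rankOne ℂ (ψ a) (ψ a) ∂μ) x) =
      ((∫ a, ‖inner ℂ x (ψ a)‖ ^ 2 ∂μ : ℝ) : ℂ) := by
  have hi := integrable_rankOne hψ h1
  rw [ContinuousLinearMap.integral_apply hi, ← integral_inner (hi.apply_continuousLinearMap x),
    ← integral_complex_ofReal]
  refine integral_congr_ae (Eventually.of_forall fun a => ?_)
  simp only [InnerProductSpace.rankOne_apply, inner_smul_right]
  rw [mul_comm, ← inner_conj_symm (ψ a) x, Complex.mul_conj, normSq_eq_norm_sq]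

lemma nonneg_integral_rankOne [CompleteSpace H] (hψ : AEStronglyMeasurable ψ μ)
    (h1 : ∀ᵐ a ∂μ, ‖ψ a‖ = 1) :
    0 ≤ ∫ a, InnerProductSpace.rankOne ℂ (ψ a) (ψ a) ∂μ := by
  rw [ContinuousLinearMap.nonneg_iff_isPositive, ContinuousLinearMap.isPositive_iff_complex]
  intro x
  rw [← inner_conj_symm, inner_integral_rankOne hψ h1, Complex.conj_ofReal]
  exact ⟨by simp, by simpa using integral_nonneg fun a => by positivity⟩

lemma hasTrace_integral_rankOne [CompleteSpace H] [SecondCountableTopology H]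
    (hψ : AEStronglyMeasurable ψ μ) (h1 : ∀ᵐ a ∂μ, ‖ψ a‖ = 1) :
    HasTrace (∫ a, InnerProductSpace.rankOne ℂ (ψ a) (ψ a) ∂μ) (μ.real Set.univ : ℂ) := by
  intro w b
  have : Countable w := countable_of_orthonormal b.orthonormal
  simp only [inner_integral_rankOne hψ h1]
  rw [Complex.hasSum_ofReal]
  have hint : ∀ i, Integrable (fun a => ‖inner ℂ (b i) (ψ a)‖ ^ 2) μ := by
    intro i
    refine Integrable.of_bound (C := 1) ?_ ?_
    · have hc : Continuous fun x : H => ‖inner ℂ (b i) x‖ ^ 2 := by fun_prop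
      exact hc.comp_aestronglyMeasurable hψ
    · filter_upwards [h1] with a ha
      rw [Real.norm_of_nonneg (by positivity)]
      refine pow_le_one₀ (norm_nonneg _) ?_
      simpa [ha, b.orthonormal.1 i] using norm_inner_le_norm (𝕜 := ℂ) (b i) (ψ a)
  -- By Bessel's inequality every finite partial sum is at most the total mass, which justifies
  -- exchanging sum and integral.
  have hsum : Summable fun i => ∫ a, ‖(‖inner ℂ (b i) (ψ a)‖ ^ 2)‖ ∂μ := by
    refine summable_of_sum_le (c := μ.real Set.univ)
      (fun i => integral_nonneg fun a => norm_nonneg _) fun u => ?_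
    rw [← integral_finsetSum _ fun i _ => (hint i).norm]
    have h2 : ∫ _, (1 : ℝ) ∂μ = μ.real Set.univ := by simp
    rw [← h2]
    refine integral_mono_ae (integrable_finsetSum _ fun i _ => (hint i).norm)
      (integrable_const 1) ?_
    filter_upwards [h1] with a ha
    simpa [ha] using b.orthonormal.sum_inner_products_le (ψ a) (s := u)
  have h := hasSum_integral_of_summable_integral_norm hint hsum
  have h3 : ∫ a, ∑' i, ‖inner ℂ (b i) (ψ a)‖ ^ 2 ∂μ = μ.real Set.univ := by
    have h2 : ∫ _, (1 : ℝ) ∂μ = μ.real Set.univ := by simp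
    rw [← h2]
    refine integral_congr_ae ?_
    filter_upwards [h1] with a ha
    -- Parseval: the summed integrand is `‖ψ a‖² = 1`.
    have h4 := b.hasSum_inner_mul_inner (ψ a) (ψ a)
    rw [inner_self_eq_norm_sq_to_K, ha] at h4
    have h5 : ∀ i, inner ℂ (ψ a) (b i) * inner ℂ (b i) (ψ a) =
        ((‖inner ℂ (b i) (ψ a)‖ ^ 2 : ℝ) : ℂ) := by
      intro i
      rw [mul_comm, ← inner_conj_symm (ψ a) (b i), Complex.mul_conj, normSq_eq_norm_sq]
    simp only [h5] at h4
    refine HasSum.tsum_eq ?_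
    rw [← Complex.hasSum_ofReal]
    simpa using h4
  rwa [h3] at h

lemma isTraceClass_integral_rankOne [CompleteSpace H] [SecondCountableTopology H]
    (hψ : AEStronglyMeasurable ψ μ) (h1 : ∀ᵐ a ∂μ, ‖ψ a‖ = 1) :
    IsTraceClass (∫ a, InnerProductSpace.rankOne ℂ (ψ a) (ψ a) ∂μ) := by
  intro w b
  rw [CFC.abs_of_nonneg _ (nonneg_integral_rankOne hψ h1)]
  exact (hasTrace_integral_rankOne hψ h1 w b).summable

end Trace

/-! ### Numerical bounds -/

lemma trace_add_one_le {m K η : ℝ} (hm : 33 ≤ m) (hK : m ≤ K) (hη : η = (K - m) / (K + m)) :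
    (m + 4) * (m + 3) ^ 2 * (m + 2) * η ^ 4 / (12 * (1 - η) ^ 4) + 1 ≤ K ^ 4 / 100 := by
  have hKm : 0 < K + m := by linarith
  have h1 : 1 - η = 2 * m / (K + m) := by rw [hη]; field_simp; ring
  have h2 : (m + 4) * (m + 3) ^ 2 * (m + 2) * η ^ 4 / (12 * (1 - η) ^ 4) =
      (m + 4) * (m + 3) ^ 2 * (m + 2) / (192 * m ^ 4) * (K - m) ^ 4 := by
    rw [h1, hη]
    field_simp
    ring
  -- The ratio is largest at `m = 33`, about `0.00737`. The bound `3 / 400` leaves `K ^ 4 / 400` in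
  -- reserve, which exceeds `1` since `K ≥ 33`.
  have h3 : (m + 4) * (m + 3) ^ 2 * (m + 2) / (192 * m ^ 4) ≤ 3 / 400 := by
    rw [div_le_iff₀ (by positivity)]
    have h4 : m + 4 ≤ 37 / 33 * m := by linarith
    have h5 : m + 3 ≤ 36 / 33 * m := by linarith
    have h6 : m + 2 ≤ 35 / 33 * m := by linarith
    calc (m + 4) * (m + 3) ^ 2 * (m + 2) ≤ (37 / 33 * m) * (36 / 33 * m) ^ 2 * (35 / 33 * m) := by
          gcongr
      _ ≤ 3 / 400 * (192 * m ^ 4) := by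
          have : 0 ≤ m ^ 4 := by positivity
          nlinarith
  have h7 : (K - m) ^ 4 ≤ K ^ 4 := pow_le_pow_left₀ (by linarith) (by linarith) 4
  have h8 : (33 : ℝ) ^ 4 ≤ K ^ 4 := pow_le_pow_left₀ (by norm_num) (by linarith) 4
  have h9 : (m + 4) * (m + 3) ^ 2 * (m + 2) / (192 * m ^ 4) * (K - m) ^ 4 ≤ 3 / 400 * K ^ 4 := by
    gcongr
  rw [h2]
  linarith

end SU22
end

/-! ### The trace of the cut operator and its bounds. -/

theorem mainTheorem6 (n : ℕ) (hn : 38 ≤ n) (K η : ℝ) (hK : (n : ℝ) - 5 ≤ K)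
    (hη : η = (K - (n : ℝ) + 5) / (K + (n : ℝ) - 5)) :
    IntegrableOn (SU22.projector n) (SU22.cutDomain η) (SU22.invMeasure n) ∧
    SU22.IsTraceClass (SU22.cutOperator n η) ∧
    ∃ T : ℝ, SU22.HasTrace (SU22.cutOperator n η) (T : ℂ) ∧
      T = ((n : ℝ) - 1) * ((n : ℝ) - 2) ^ 2 * ((n : ℝ) - 3) * η ^ 4 / (12 * (1 - η) ^ 4) ∧
      T ≤ K ^ 4 / 100 ∧
      T + 1 ≤ K ^ 4 / 100 := by
  have hn' : (38 : ℝ) ≤ n := by exact_mod_cast hn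
  have hpos : 0 < K + (n : ℝ) - 5 := by linarith
  have hη0 : 0 ≤ η := by rw [hη]; exact div_nonneg (by linarith) hpos.le
  have hη1 : η < 1 := by rw [hη, div_lt_one hpos]; linarith
  have hvol := SU22.invMeasure_cutDomain (by lia : 3 ≤ n) hη0 hη1
  set T := ((n : ℝ) - 1) * ((n : ℝ) - 2) ^ 2 * ((n : ℝ) - 3) * η ^ 4 / (12 * (1 - η) ^ 4) with hT
  have hT0 : 0 ≤ T := by
    have : (0 : ℝ) ≤ n - 1 := by linarith
    have : (0 : ℝ) ≤ n - 3 := by linarith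
    have : 0 ≤ 1 - η := by linarith
    positivity
  have hT1 : T + 1 ≤ K ^ 4 / 100 := by
    have h := SU22.trace_add_one_le (m := (n : ℝ) - 5) (K := K) (η := η) (by linarith) hK
      (by rw [hη]; congr 1 <;> ring)
    refine le_trans (le_of_eq ?_) h
    rw [hT]
    ring
  set μ := (SU22.invMeasure n).restrict (SU22.cutDomain η) with hμ
  have hfin : IsFiniteMeasure μ := ⟨by
    rw [hμ, Measure.restrict_apply_univ, hvol]; exact ENNReal.ofReal_lt_top⟩
  have hreal : μ.real Set.univ = T := by
    rw [hμ, measureReal_def, Measure.restrict_apply_univ, hvol, ENNReal.toReal_ofReal hT0]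
  have hmeas : AEStronglyMeasurable (SU22.coherent n) μ := by
    have h := ((SU22.continuousOn_coherent n).mono
      (SU22.cutDomain_subset_domain hη1)).aestronglyMeasurable (μ := volume)
      (SU22.measurableSet_cutDomain η)
    -- Continuity gives measurability for Lebesgue measure; absolute continuity transfers it to the
    -- invariant measure.
    have hac : SU22.invMeasure n ≪ volume :=
      (withDensity_absolutelyContinuous _ _).trans Measure.restrict_le_self.absolutelyContinuous
    exact h.mono_ac (hac.restrict _)
  have hnorm : ∀ᵐ Λ ∂μ, ‖SU22.coherent n Λ‖ = 1 := by
    refine (ae_restrict_iff' (SU22.measurableSet_cutDomain η)).2 (Eventually.of_forall ?_)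
    exact fun Λ hΛ => SU22.norm_coherent n (SU22.cutDomain_subset_domain hη1 hΛ)
  refine ⟨SU22.integrable_rankOne hmeas hnorm, SU22.isTraceClass_integral_rankOne hmeas hnorm,
    T, ?_, rfl, by linarith, hT1⟩
  have h := SU22.hasTrace_integral_rankOne hmeas hnorm
  rwa [hreal] at h
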